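/- Let $M$ be a connected smooth three-dimensional manifold (Hausdorff, second countable) with a paracontact metric structure $(\varphi,\xi,\eta,g)$. That is, $\varphi$ is a smooth $(1,1)$-tensor field, $\xi$ a smooth vector field, $\eta$ a smooth $1$-form and $g$ a smooth pseudo-Riemannian metric such that $$\varphi\xi=0,\quad \eta\circ\varphi=0,\quad \eta(\xi)=1,\quad \varphi^2=\mathrm{Id}-\eta\otimes\xi,\quad g(\varphi X,\varphi Y)=-g(X,Y)+\eta(X)\eta(Y),$$ the $\pm1$-eigenspaces of $\varphi|_{\ker\eta}$ have equal dimension, and $g(X,\varphi Y)=d\eta(X,Y)$, where $d\eta(X,Y)=\tfrac12\big(X\eta(Y)-Y\eta(X)-\eta([X,Y])\big)$. Assume that it is a nontrivial paracontact Ricci soliton: $\mathcal L_\xi g+\varrho=\lambda g$ for some real constant $\lambda$, where $\varrho$ is the Ricci tensor of $g$, and $g$ is not Einstein ($\varrho\ne k g$ for every real constant $k$). Let $Q$ be the Ricci operator, $g(QX,Y)=\varrho(X,Y)$. Then: (1) At every point $p\in M$ all eigenvalues of $Q_p$ are equal to $-2$, i.e. the characteristic polynomial of $Q_p$ is $(t+2)^3$.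 (2) There are points $p$ at which the soliton is nontrivial, in the sense that $\varrho_p$ is not a multiple of $g_p$. At every such point the eigenspace of $Q_p$ for the eigenvalue $-2$ is two-dimensional, and $Q_p$ has the degenerate Segre type $\{(2,1)\}$: its Jordan form consists of one block of size $2$ and one of size $1$ with the same eigenvalue, with a Jordan basis $(b_0,b_1,b_2)$ in Lorentzian canonical form, i.e. $g(b_0,b_0)=g(b_1,b_1)=0$, $g(b_0,b_1)=\pm1$, $g(b_2,b_2)=1$, $g(b_2,b_0)=g(b_2,b_1)=0$, and $Q_pb_0=-2b_0$, $Q_pb_1=-2b_1+b_0$, $Q_pb_2=-2b_2$. -/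

import Mathlib

open scoped Manifold ContDiff Bundle

noncomputable section

/-- The model space of three-dimensional manifolds. -/
abbrev E3 : Type := EuclideanSpace ℝ (Fin 3)

/-! ### Tensor calculus in a coordinate domain of `ℝ³` -/

namespace Coord

/-- The `i`-th partial derivative of `f` at `y`. -/
def pd (i : Fin 3) (f : E3 → ℝ) (y : E3) : ℝ :=
  fderiv ℝ f y (EuclideanSpace.single i 1)

/-- The Christoffel symbols `Γᵏᵢⱼ` of the Levi-Civita connection of the metric with
components `G`. -/
def christoffel (G : E3 → Matrix (Fin 3) (Fin 3) ℝ) (k i j : Fin 3) (y : E3) : ℝ :=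
  (1 / 2) * ∑ l, (G y)⁻¹ k l *
    (pd i (fun z => G z j l) y + pd j (fun z => G z i l) y - pd l (fun z => G z i j) y)

/-- The component `l` of `∇_{∂ᵢ} ∇_{∂ⱼ} ∂ₖ - ∇_{∂ⱼ} ∇_{∂ᵢ} ∂ₖ`. -/
def riemann (G : E3 → Matrix (Fin 3) (Fin 3) ℝ) (l i j k : Fin 3) (y : E3) : ℝ :=
  pd i (christoffel G l j k) y - pd j (christoffel G l i k) y
    + ∑ m, (christoffel G l i m y * christoffel G m j k y
        - christoffel G l j m y * christoffel G m i k y)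

/-- The components of the Ricci tensor `ϱ(∂ⱼ, ∂ₖ)`, the trace of
`X ↦ ∇_X ∇_{∂ⱼ} ∂ₖ - ∇_{∂ⱼ} ∇_X ∂ₖ - ∇_{[X, ∂ⱼ]} ∂ₖ`
(on the round sphere this is positive definite). -/
def ricci (G : E3 → Matrix (Fin 3) (Fin 3) ℝ) (y : E3) : Matrix (Fin 3) (Fin 3) ℝ :=
  Matrix.of fun j k => ∑ i, riemann G i i j k y

/-- The components of the Lie derivative `𝓛_X g`, where `X` has the components `X` and
`g` the components `G`. -/
def lieDerivMetric (X : E3 → Fin 3 → ℝ) (G : E3 → Matrix (Fin 3) (Fin 3) ℝ) (y : E3) :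
    Matrix (Fin 3) (Fin 3) ℝ :=
  Matrix.of fun i j => ∑ k, (X y k * pd k (fun z => G z i j) y
    + G y k j * pd i (fun z => X z k) y + G y i k * pd j (fun z => X z k) y)

/-- The components of `dη`, with the convention
`dη(X, Y) = (X (η Y) - Y (η X) - η [X, Y]) / 2`. -/
def extDeriv₁ (η : E3 → Fin 3 → ℝ) (y : E3) : Matrix (Fin 3) (Fin 3) ℝ :=
  Matrix.of fun i j => (1 / 2) * (pd i (fun z => η z j) y - pd j (fun z => η z i) y)

end Coord

/-! ### Almost paracontact metric structures on three-manifolds -/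

section Manifold

variable (M : Type*) [TopologicalSpace M] [ChartedSpace E3 M] [IsManifold 𝓘(ℝ, E3) ∞ M]

/-- A (smooth) almost paracontact metric structure `(φ, ξ, η, g)` on a three-manifold. -/
structure AlmostParacontactMetric where
  /-- the `(1,1)`-tensor -/
  φ : Π x : M, TangentSpace 𝓘(ℝ, E3) x →L[ℝ] TangentSpace 𝓘(ℝ, E3) x
  /-- the Reeb vector field -/
  ξ : Π x : M, TangentSpace 𝓘(ℝ, E3) x
  /-- the `1`-form -/
  η : Π x : M, TangentSpace 𝓘(ℝ, E3) x →L[ℝ] ℝ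
  /-- the pseudo-Riemannian metric -/
  g : Π x : M, TangentSpace 𝓘(ℝ, E3) x →L[ℝ] TangentSpace 𝓘(ℝ, E3) x →L[ℝ] ℝ
  smooth_φ : ContMDiff 𝓘(ℝ, E3) (𝓘(ℝ, E3).prod 𝓘(ℝ, E3 →L[ℝ] E3)) ∞
    (fun x => Bundle.TotalSpace.mk' (E3 →L[ℝ] E3) x (φ x))
  smooth_ξ : ContMDiff 𝓘(ℝ, E3) (𝓘(ℝ, E3).prod 𝓘(ℝ, E3)) ∞
    (fun x => Bundle.TotalSpace.mk' E3 x (ξ x))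
  smooth_η : ContMDiff 𝓘(ℝ, E3) (𝓘(ℝ, E3).prod 𝓘(ℝ, E3 →L[ℝ] ℝ)) ∞
    (fun x => Bundle.TotalSpace.mk' (E3 →L[ℝ] ℝ) x (η x))
  smooth_g : ContMDiff 𝓘(ℝ, E3) (𝓘(ℝ, E3).prod 𝓘(ℝ, E3 →L[ℝ] E3 →L[ℝ] ℝ)) ∞
    (fun x => Bundle.TotalSpace.mk' (E3 →L[ℝ] E3 →L[ℝ] ℝ) x (g x))
  φ_ξ : ∀ x, φ x (ξ x) = 0
  η_φ : ∀ x v, η x (φ x v) = 0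
  η_ξ : ∀ x, η x (ξ x) = 1
  φ_sq : ∀ x v, φ x (φ x v) = v - η x v • ξ x
  /-- the eigenspaces of `φ` on `ker η` for the eigenvalues `1` and `-1` have the same
  dimension (hence both are lines) -/
  paracomplex : ∀ x,
    Module.finrank ℝ ↥(LinearMap.ker (η x).toLinearMap ⊓
      Module.End.eigenspace (φ x).toLinearMap (1 : ℝ)) =
    Module.finrank ℝ ↥(LinearMap.ker (η x).toLinearMap ⊓
      Module.End.eigenspace (φ x).toLinearMap (-1 : ℝ))
  g_symm : ∀ x v w, g x v w = g x w v
  g_nondegenerate : ∀ x v, (∀ w, g x v w = 0) → v = 0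
  /-- the metric is compatible with the almost paracontact structure -/
  g_compat : ∀ x v w, g x (φ x v) (φ x w) = - g x v w + η x v * η x w

variable {M}

instance (p : M) : FiniteDimensional ℝ (TangentSpace 𝓘(ℝ, E3) p) :=
  inferInstanceAs (FiniteDimensional ℝ E3)

/-- The coordinate tangent vector `∂ᵢ` of the chart `c` at the point with coordinates `y`. -/
def coordVec (c : OpenPartialHomeomorph M E3) (i : Fin 3) (y : E3) :
    TangentSpace 𝓘(ℝ, E3) (c.symm y) :=
  mfderiv 𝓘(ℝ, E3) 𝓘(ℝ, E3) c.symm y (EuclideanSpace.single i (1 : ℝ) : E3)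

namespace AlmostParacontactMetric

variable (S : AlmostParacontactMetric M) (c : OpenPartialHomeomorph M E3)

/-- The components of `g` in the chart `c`. -/
def gC (y : E3) : Matrix (Fin 3) (Fin 3) ℝ :=
  Matrix.of fun i j => S.g (c.symm y) (coordVec c i y) (coordVec c j y)

/-- The components of `ξ` in the chart `c`. -/
def ξC (y : E3) : Fin 3 → ℝ :=
  fun i => (show E3 from mfderiv 𝓘(ℝ, E3) 𝓘(ℝ, E3) c (c.symm y) (S.ξ (c.symm y))) i

/-- The components of `η` in the chart `c`. -/
def ηC (y : E3) : Fin 3 → ℝ :=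
  fun i => S.η (c.symm y) (coordVec c i y)

/-- The components of the fundamental `2`-form `Φ(X, Y) = g(X, φ Y)` in the chart `c`. -/
def fundFormC (y : E3) : Matrix (Fin 3) (Fin 3) ℝ :=
  Matrix.of fun i j =>
    S.g (c.symm y) (coordVec c i y) (S.φ (c.symm y) (coordVec c j y))

/-- The components of the Ricci tensor of `g` in the chart `c`. -/
def ricciC (y : E3) : Matrix (Fin 3) (Fin 3) ℝ := Coord.ricci (S.gC c) y

/-- The components of `𝓛_ξ g` in the chart `c`. -/
def lieC (y : E3) : Matrix (Fin 3) (Fin 3) ℝ := Coord.lieDerivMetric (S.ξC c) (S.gC c) y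

/-- Paracontact metric structures: `Φ = dη`, in all smooth charts. -/
def IsParacontactMetric : Prop :=
  ∀ c ∈ IsManifold.maximalAtlas 𝓘(ℝ, E3) ∞ M, ∀ y ∈ c.target,
    S.fundFormC c y = Coord.extDeriv₁ (S.ηC c) y

/-- The Reeb vector field satisfies the Ricci soliton equation `𝓛_ξ g + ϱ = lam • g`
(in all smooth charts) with a real constant `lam`. -/
def IsReebRicciSoliton : Prop :=
  ∃ lam : ℝ, ∀ c ∈ IsManifold.maximalAtlas 𝓘(ℝ, E3) ∞ M, ∀ y ∈ c.target,
    S.lieC c y + S.ricciC c y = lam • S.gC c y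

/-- `g` is an Einstein metric: `ϱ = k • g` with a real constant `k`. -/
def IsEinstein : Prop :=
  ∃ k : ℝ, ∀ c ∈ IsManifold.maximalAtlas 𝓘(ℝ, E3) ∞ M, ∀ y ∈ c.target,
    S.ricciC c y = k • S.gC c y

/-- The Ricci tensor at `p` is a multiple of the metric at `p` (for a smooth chart `c`
around `p`). -/
def IsEinsteinAt (p : M) : Prop :=
  ∃ k : ℝ, S.ricciC c (c p) = k • S.gC c (c p)

/-- The Ricci operator `Q` at a point `p` of the domain of the smooth chart `c`, that is, the
endomorphism of the tangent space with `g(Q v, w) = ϱ(v, w)`: in the basis `∂₁, ∂₂, ∂₃` its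
matrix is the inverse of the matrix of `g` times the matrix of `ϱ`. -/
def ricciOperator (p : M) :
    TangentSpace 𝓘(ℝ, E3) p →ₗ[ℝ] TangentSpace 𝓘(ℝ, E3) p :=
  (show E3 →L[ℝ] E3 from mfderiv 𝓘(ℝ, E3) 𝓘(ℝ, E3) c.symm (c p)).toLinearMap ∘ₗ
    Matrix.toLpLin 2 2 ((S.gC c (c p))⁻¹ * S.ricciC c (c p)) ∘ₗ
    (show E3 →L[ℝ] E3 from mfderiv 𝓘(ℝ, E3) 𝓘(ℝ, E3) c p).toLinearMap

end AlmostParacontactMetric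

end Manifold

/-- A self-adjoint operator `Q` on a three-dimensional Lorentzian vector space with scalar
product `B` has the degenerate Segre type `{(2,1)}`: its Jordan form has one block of size `2`
and one of size `1`, both with the same real eigenvalue. The Jordan basis can be taken in the
usual canonical form: `b 0`, `b 1` null with `B (b 0) (b 1) = ±1` and `b 2` a unit
space-like vector orthogonal to both. -/
def HasDegenerateSegreType21 {V : Type*} [AddCommGroup V] [Module ℝ V]
    (B : V → V → ℝ) (Q : V →ₗ[ℝ] V) : Prop :=
  ∃ (μ ε : ℝ) (b : Module.Basis (Fin 3) ℝ V), (ε = 1 ∨ ε = -1) ∧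
    Q (b 0) = μ • b 0 ∧ Q (b 1) = μ • b 1 + b 0 ∧ Q (b 2) = μ • b 2 ∧
    ∀ i j, B (b i) (b j) = (!![0, ε, 0; ε, 0, 0; 0, 0, 1] : Matrix (Fin 3) (Fin 3) ℝ) i j

end

/-! Write P = g⁻¹ 𝓛_ξ g. Since η(ξ) = 1 and dη(ξ, ·) = 0, Cartan's formula gives 𝓛_ξ η = 0 and 𝓛_ξ
dη = 0. Hence P kills ξ, has its image in ker η, and anticommutes with φ; therefore P, P² φ and P³
are trace-free. The covariant derivative of ξ is P/2 − φ, and ξ is geodesic.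

The Jacobi operator J(X) = R(X, ξ)ξ satisfies the Riccati equation J = −𝓛_ξ(∇ξ) − (∇ξ)² (`riccati`).
Its trace is ϱ(ξ, ξ) = −2 − tr(P²)/4, whereas the soliton equation contracted with ξ gives ϱ(ξ, ξ) =
λ. So tr(P²) is constant, and then the Riccati equation multiplied by P gives tr(PJ) = 0
(`trace_shape_jacobiOp`).

In dimension three, for a trace-free symmetric tensor on ker η, contraction with J equals
contraction with ϱ (`sum_skew_eq_sum_skew`). With ϱ = λg − 𝓛_ξ g this reads 0 = tr(PJ) = λ tr P −
tr(P²) = −tr(P²). Thus tr(P²) = 0 and λ = −2.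

On the plane ker η, P has zero trace and zero trace of its square, so P² = 0. As Q = −2 − P,
everything about the spectrum and the Jordan form follows from linear algebra
(`exists_jordan_basis`). -/

noncomputable section

open Matrix

/-! ### Product rules for matrices over a differential ring. -/

namespace MatrixCalculus

variable {R : Type*} [CommRing R] [Algebra ℝ R]

lemma map_mul {l m n : Type*} [Fintype m] (δ : Derivation ℝ R R) (P : Matrix l m R)
    (Q : Matrix m n R) : (P * Q).map δ = P.map δ * Q + P * Q.map δ := by
  ext i j
  simp [Matrix.mul_apply, Finset.sum_add_distrib, mul_comm, add_comm]

lemma map_mulVec {m : Type*} [Fintype m] (δ : Derivation ℝ R R) (P : Matrix m m R)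
    (v : m → R) (i : m) : δ ((P *ᵥ v) i) = (P.map δ *ᵥ v) i + (P *ᵥ fun j => δ (v j)) i := by
  simp [Matrix.mulVec, dotProduct, Finset.sum_add_distrib, mul_comm, add_comm]

lemma map_trace {m : Type*} [Fintype m] (δ : Derivation ℝ R R) (P : Matrix m m R) :
    δ P.trace = (P.map δ).trace := by
  simp [Matrix.trace]

end MatrixCalculus

/-! ### Levi-Civita calculus over a ring with derivations, up to the Riccati equation. -/

namespace FormalGeometry

variable {R : Type*} [CommRing R] [Algebra ℝ R] (d : Fin 3 → Derivation ℝ R R)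

/-- Christoffel symbols of a matrix `G` with inverse `K` over a differential ring; the matrix
`gam d G K i` has the entries `Γᵏᵢⱼ`. -/
def gam (G K : Matrix (Fin 3) (Fin 3) R) (i : Fin 3) : Matrix (Fin 3) (Fin 3) R :=
  of fun k j => (1 / 2 : ℝ) • ∑ l, K k l * (d i (G j l) + d j (G i l) - d l (G i j))

/-- The curvature endomorphisms `R(∂ᵢ, ∂ⱼ)`. -/
def curv (G K : Matrix (Fin 3) (Fin 3) R) (i j : Fin 3) : Matrix (Fin 3) (Fin 3) R :=
  (gam d G K j).map (d i) - (gam d G K i).map (d j) +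
    (gam d G K i * gam d G K j - gam d G K j * gam d G K i)

/-- The Ricci tensor. -/
def ric (G K : Matrix (Fin 3) (Fin 3) R) : Matrix (Fin 3) (Fin 3) R :=
  of fun j k => ∑ i, curv d G K i j i k

/-- The Jacobian matrix of a vector field. -/
def jac (ξ : Fin 3 → R) : Matrix (Fin 3) (Fin 3) R := of fun l i => d i (ξ l)

/-- The derivation along a vector field. -/
def along (ξ : Fin 3 → R) : Derivation ℝ R R := ∑ k, ξ k • d k

lemma along_apply (ξ : Fin 3 → R) (f : R) : along d ξ f = ∑ k, ξ k * d k f := by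
  have h := congrFun (map_sum Derivation.coeFnAddMonoidHom (fun k => ξ k • d k) Finset.univ) f
  rw [Finset.sum_apply] at h
  exact h

/-- The Lie derivative of a bilinear form. -/
def lieForm (ξ : Fin 3 → R) (G : Matrix (Fin 3) (Fin 3) R) : Matrix (Fin 3) (Fin 3) R :=
  G.map (along d ξ) + (jac d ξ)ᵀ * G + G * jac d ξ

/-- The Lie derivative of an endomorphism. -/
def lieEnd (ξ : Fin 3 → R) (P : Matrix (Fin 3) (Fin 3) R) : Matrix (Fin 3) (Fin 3) R :=
  P.map (along d ξ) - jac d ξ * P + P * jac d ξ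

/-- The exterior derivative of a one-form, with the factor `1 / 2`. -/
def extDer (η : Fin 3 → R) : Matrix (Fin 3) (Fin 3) R :=
  of fun i j => (1 / 2 : ℝ) • (d i (η j) - d j (η i))

/-- The covariant derivative of a vector field. -/
def nab (G K : Matrix (Fin 3) (Fin 3) R) (ξ : Fin 3 → R) : Matrix (Fin 3) (Fin 3) R :=
  of fun l i => d i (ξ l) + (gam d G K i *ᵥ ξ) l

variable {d}

lemma two_half (x : R) : (2 : R) * ((1 / 2 : ℝ) • x) = x := by
  rw [Algebra.smul_def, ← mul_assoc, ← map_ofNat (algebraMap ℝ R) 2, ← map_mul]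
  norm_num

lemma two_cancel {x y : R} (h : (2 : R) * x = 2 * y) : x = y := by
  rw [← two_half x, ← two_half y, Algebra.smul_def, Algebra.smul_def, mul_left_comm, h,
    mul_left_comm]

section metric

variable {G K : Matrix (Fin 3) (Fin 3) R}

/-- Koszul's formula, with the index lowered so that the inverse metric disappears. -/
lemma mul_gam (hGK : G * K = 1) (i k j : Fin 3) :
    (2 : R) * (G * gam d G K i) k j = d i (G j k) + d j (G i k) - d k (G i j) := by
  have h : gam d G K i = (1 / 2 : ℝ) • (K * of fun l j => d i (G j l) + d j (G i l) - d l (G i j)) := by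
    ext; simp [gam, Matrix.mul_apply]
  rw [h, mul_smul_comm, ← Matrix.mul_assoc, hGK, Matrix.one_mul, Matrix.smul_apply, two_half]
  rfl

lemma symm_apply {R : Type*} {G : Matrix (Fin 3) (Fin 3) R} (hG : Gᵀ = G) (i j : Fin 3) :
    G i j = G j i := by
  conv_lhs => rw [← hG]
  rfl

lemma gam_symm (hG : Gᵀ = G) (i j k : Fin 3) : gam d G K i k j = gam d G K j k i := by
  simp only [gam, of_apply]
  congr 1
  refine Finset.sum_congr rfl fun l _ => ?_
  rw [symm_apply hG i j]; ring

/-- This is ∇g = 0: the Koszul formula added to its transpose. -/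
lemma map_metric (hG : Gᵀ = G) (hGK : G * K = 1) (i : Fin 3) :
    G.map (d i) = G * gam d G K i + (gam d G K i)ᵀ * G := by
  have h : (gam d G K i)ᵀ * G = (G * gam d G K i)ᵀ := by rw [transpose_mul, hG]
  rw [h]
  ext k j
  apply two_cancel
  rw [Matrix.add_apply, transpose_apply, mul_add, mul_gam hGK, mul_gam hGK, map_apply,
    symm_apply hG j k]
  ring

/-- Differentiate ∇g = 0 once more: since second derivatives of `G` commute, the antisymmetrised
expression vanishes, and it is the symmetric part of the lowered curvature. -/
lemma curv_skew (hd : ∀ i j f, d i (d j f) = d j (d i f)) (hG : Gᵀ = G) (hGK : G * K = 1)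
    (i j : Fin 3) : (G * curv d G K i j)ᵀ = - (G * curv d G K i j) := by
  have key : ∀ i j, (G.map (d j)).map (d i) =
      (G * gam d G K i + (gam d G K i)ᵀ * G) * gam d G K j + G * (gam d G K j).map (d i)
      + (((gam d G K j).map (d i))ᵀ * G
        + (gam d G K j)ᵀ * (G * gam d G K i + (gam d G K i)ᵀ * G)) := by
    intro i j
    rw [map_metric hG hGK j]
    have : ∀ P Q : Matrix (Fin 3) (Fin 3) R, (P + Q).map (d i) = P.map (d i) + Q.map (d i) :=
      fun P Q => Matrix.map_add _ (map_add _) P Q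
    rw [this, MatrixCalculus.map_mul, MatrixCalculus.map_mul, map_metric hG hGK i,
      transpose_map]
  have hc : (G.map (d j)).map (d i) = (G.map (d i)).map (d j) := by
    ext a b; simp [hd i j]
  rw [key i j, key j i] at hc
  rw [transpose_mul, hG, curv]
  simp only [transpose_add, transpose_sub, transpose_mul]
  rw [← sub_eq_zero] at hc ⊢
  rw [← hc]
  noncomm_ring

lemma curv_swap (i j : Fin 3) : curv d G K j i = - curv d G K i j := by
  simp only [curv]; abel

variable {ξ : Fin 3 → R}

/-- The Ricci identity for a vector field. -/
lemma ricci_identity (hd : ∀ i j f, d i (d j f) = d j (d i f)) (i j l : Fin 3) :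
    (curv d G K i j *ᵥ ξ) l =
      d i (nab d G K ξ l j) + (gam d G K i *ᵥ fun m => nab d G K ξ m j) l
      - (d j (nab d G K ξ l i) + (gam d G K j *ᵥ fun m => nab d G K ξ m i) l) := by
  have e : ∀ i, (fun m => nab d G K ξ m i) = (fun m => d i (ξ m)) + gam d G K i *ᵥ ξ := by
    intro i; ext m; rfl
  rw [e, e]
  simp only [nab, of_apply, map_add, MatrixCalculus.map_mulVec, mulVec_add, Pi.add_apply, curv,
    add_mulVec, sub_mulVec, Pi.sub_apply, mulVec_mulVec, hd i j]
  ring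

/-- Torsion-freeness in matrix form; it converts ∇_ξ into 𝓛_ξ in `riccati`. -/
lemma nab_eq (hG : Gᵀ = G) :
    ∑ m, ξ m • gam d G K m = nab d G K ξ - jac d ξ := by
  ext l i
  simp only [Matrix.sum_apply, Matrix.smul_apply, Matrix.sub_apply, nab, jac, of_apply,
    add_sub_cancel_left, mulVec, dotProduct, smul_eq_mul]
  exact Finset.sum_congr rfl fun m _ => by rw [gam_symm hG, mul_comm]

/-- The Jacobi operator of `ξ`, that is, `X ↦ R(X, ξ) ξ`. -/
def jacobiOp (d : Fin 3 → Derivation ℝ R R) (G K : Matrix (Fin 3) (Fin 3) R) (ξ : Fin 3 → R) :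
    Matrix (Fin 3) (Fin 3) R :=
  of fun l i => ∑ j, ξ j * (curv d G K i j *ᵥ ξ) l

/-- The Riccati equation for a geodesic vector field. -/
lemma riccati (hd : ∀ i j f, d i (d j f) = d j (d i f)) (hG : Gᵀ = G)
    (hgeo : nab d G K ξ *ᵥ ξ = 0) :
    jacobiOp d G K ξ = - lieEnd d ξ (nab d G K ξ) - nab d G K ξ * nab d G K ξ := by
  set B := nab d G K ξ with hB
  have h0 : ∀ i, gam d G K i *ᵥ (B *ᵥ ξ) = 0 := fun i => by rw [hgeo, mulVec_zero]
  have hB1 : B * B = (∑ m, ξ m • gam d G K m) * B + jac d ξ * B := by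
    rw [nab_eq hG, ← hB]; noncomm_ring
  rw [hB1, lieEnd]
  ext l i
  -- Differentiating the geodesic equation moves the derivative from ∇ξ to ξ, which leaves no second
  -- derivatives except those along ξ.
  have h1 : d i ((B *ᵥ ξ) l) = 0 := by rw [hgeo]; simp
  rw [MatrixCalculus.map_mulVec] at h1
  have h2 := congrFun (h0 i) l
  have h3 : ((∑ m, ξ m • gam d G K m) * B) l i
      = ∑ j, ξ j * (gam d G K j *ᵥ fun m => B m i) l := by
    rw [Finset.sum_mul, Matrix.sum_apply]
    refine Finset.sum_congr rfl fun j _ => ?_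
    rw [smul_mul_assoc, Matrix.smul_apply, smul_eq_mul]; rfl
  have h4 : ∑ j, ξ j * (gam d G K i *ᵥ fun m => B m j) l = (gam d G K i *ᵥ (B *ᵥ ξ)) l := by
    simp only [mulVec, dotProduct, Finset.mul_sum]
    rw [Finset.sum_comm]
    exact Finset.sum_congr rfl fun _ _ => Finset.sum_congr rfl fun _ _ => by ring
  have h5 : ∑ j, ξ j * d i (B l j) = (B.map (d i) *ᵥ ξ) l := by
    simp [mulVec, dotProduct, mul_comm]
  have h6 : (B * jac d ξ) l i = (B *ᵥ fun j => d i (ξ j)) l := rfl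
  have h7 : (B.map (along d ξ)) l i = ∑ j, ξ j * d j (B l i) := along_apply d ξ _
  simp only [jacobiOp, of_apply, ricci_identity hd, mul_sub, mul_add, Finset.sum_sub_distrib,
    Finset.sum_add_distrib, ← hB]
  simp only [Matrix.sub_apply, Matrix.neg_apply, Matrix.add_apply]
  rw [h3, h4, h5, h6, h7, h2]
  rw [Pi.zero_apply]
  linear_combination h1

lemma trace_jacobiOp : (jacobiOp d G K ξ).trace = ξ ⬝ᵥ (ric d G K *ᵥ ξ) := by
  simp only [Matrix.trace, diag, jacobiOp, of_apply, ric, mulVec, dotProduct, Finset.mul_sum,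
    Finset.sum_mul]
  rw [Finset.sum_comm]
  refine Finset.sum_congr rfl fun j _ => ?_
  rw [Finset.sum_comm]

end metric

end FormalGeometry

/-! ### Identities for P = g⁻¹ 𝓛_ξ g on a paracontact metric structure. -/

namespace FormalGeometry

variable {R : Type*} [CommRing R] [Algebra ℝ R] {d : Fin 3 → Derivation ℝ R R}

lemma lieEnd_mul (ξ : Fin 3 → R) (P Q : Matrix (Fin 3) (Fin 3) R) :
    lieEnd d ξ (P * Q) = lieEnd d ξ P * Q + P * lieEnd d ξ Q := by
  simp only [lieEnd, MatrixCalculus.map_mul]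
  noncomm_ring

lemma lieForm_mul (ξ : Fin 3 → R) (G P : Matrix (Fin 3) (Fin 3) R) :
    lieForm d ξ (G * P) = lieForm d ξ G * P + G * lieEnd d ξ P := by
  simp only [lieEnd, lieForm, MatrixCalculus.map_mul]
  noncomm_ring

lemma trace_lieEnd (ξ : Fin 3 → R) (P : Matrix (Fin 3) (Fin 3) R) :
    (lieEnd d ξ P).trace = along d ξ P.trace := by
  rw [lieEnd, trace_add, trace_sub, trace_mul_comm P, ← MatrixCalculus.map_trace]
  ring

lemma along_vec (ξ : Fin 3 → R) : (fun i => along d ξ (ξ i)) = jac d ξ *ᵥ ξ := by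
  ext i
  rw [along_apply]
  simp [jac, mulVec, dotProduct, mul_comm]

/-- The equations of a paracontact metric structure, over a differential ring. -/
structure IsParacontact (d : Fin 3 → Derivation ℝ R R) (G K F : Matrix (Fin 3) (Fin 3) R)
    (ξ η : Fin 3 → R) : Prop where
  comm : ∀ i j f, d i (d j f) = d j (d i f)
  symm : Gᵀ = G
  inv : G * K = 1
  lower : G *ᵥ ξ = η
  unit : η ⬝ᵥ ξ = 1
  sq : F * F = 1 - vecMulVec ξ η
  reeb : F *ᵥ ξ = 0
  contact : G * F = extDer d η

namespace IsParacontact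

variable {G K F : Matrix (Fin 3) (Fin 3) R} {ξ η : Fin 3 → R} (h : IsParacontact d G K F ξ η)
include h

lemma inv' : K * G = 1 := mul_eq_one_comm.1 h.inv

lemma inv_symm : Kᵀ = K := by
  have h1 : Kᵀ * G = 1 := by
    have := congrArg transpose h.inv
    rwa [transpose_mul, h.symm, transpose_one] at this
  calc Kᵀ = Kᵀ * (G * K) := by rw [h.inv, Matrix.mul_one]
    _ = K := by rw [← Matrix.mul_assoc, h1, Matrix.one_mul]

lemma raise : K *ᵥ η = ξ := by
  rw [← h.lower, mulVec_mulVec, h.inv', one_mulVec]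

lemma extDer_reeb : extDer d η *ᵥ ξ = 0 := by
  rw [← h.contact, ← mulVec_mulVec, h.reeb, mulVec_zero]

/-- Cartan's formula: 𝓛_ξ η = d(η(ξ)) + 2 dη(ξ, ·), and both terms vanish (the 2 comes from the
convention for dη). -/
lemma lie_form (i : Fin 3) : along d ξ (η i) + ((jac d ξ)ᵀ *ᵥ η) i = 0 := by
  have h1 : d i (η ⬝ᵥ ξ) = 0 := by rw [h.unit]; simp
  have h2 : 2 * (extDer d η *ᵥ ξ) i = 0 := by rw [h.extDer_reeb]; simp
  have h3 : 2 * (extDer d η *ᵥ ξ) i = ∑ k, (d i (η k) - d k (η i)) * ξ k := by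
    simp only [mulVec, dotProduct, Finset.mul_sum, extDer, of_apply]
    refine Finset.sum_congr rfl fun k _ => ?_
    rw [← mul_assoc, two_half]
  rw [h3] at h2
  rw [along_apply]
  simp only [dotProduct, map_sum, Derivation.leibniz, smul_eq_mul, Finset.sum_add_distrib] at h1
  simp only [sub_mul, Finset.sum_sub_distrib] at h2
  simp only [mulVec, dotProduct, transpose_apply, jac, of_apply]
  have e1 : ∑ k, ξ k * d k (η i) = ∑ k, d k (η i) * ξ k := by simp only [mul_comm]
  have e2 : ∑ k, ξ k * d i (η k) = ∑ k, d i (η k) * ξ k := by simp only [mul_comm]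
  have e3 : ∑ k, d i (ξ k) * η k = ∑ k, η k * d i (ξ k) := by simp only [mul_comm]
  rw [e1, e3]
  linear_combination h1 - h2 - e2

lemma lieForm_metric_reeb : lieForm d ξ G *ᵥ ξ = 0 := by
  ext i
  have h1 := h.lie_form i
  have h2 := MatrixCalculus.map_mulVec (along d ξ) G ξ i
  rw [along_vec, h.lower] at h2
  simp only [lieForm, add_mulVec, Pi.add_apply, ← mulVec_mulVec, h.lower, Pi.zero_apply]
  rw [h2] at h1
  linear_combination h1

lemma lieForm_metric_symm : (lieForm d ξ G)ᵀ = lieForm d ξ G := by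
  simp only [lieForm, transpose_add, transpose_mul, transpose_transpose, h.symm,
    ← transpose_map]
  abel

/-- Again Cartan's formula: dη is closed and ξ lies in its kernel. -/
lemma lieForm_extDer : lieForm d ξ (extDer d η) = 0 := by
  have e0 : ∀ i, ∑ k, extDer d η i k * ξ k = 0 := fun i => congrFun h.extDer_reeb i
  have skew : ∀ i j, extDer d η i j = - extDer d η j i := fun i j => by
    simp only [extDer, of_apply]; rw [← smul_neg]; congr 1; ring
  ext i j
  apply two_cancel
  have h1 : d j (∑ k, extDer d η i k * ξ k) = 0 := by rw [e0]; simp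
  have h2 : d i (∑ k, extDer d η j k * ξ k) = 0 := by rw [e0]; simp
  have h3 : ∀ k i j, (2 : R) * d k (extDer d η i j) = d k (d i (η j)) - d k (d j (η i)) := by
    intro k i j
    rw [← map_sub]
    simp only [extDer, of_apply, Derivation.map_smul, two_half]
  simp only [map_sum, Derivation.leibniz, smul_eq_mul, Finset.sum_add_distrib] at h1 h2
  simp only [lieForm, Matrix.add_apply, map_apply, along_apply, Matrix.mul_apply, transpose_apply,
    jac, of_apply, Matrix.zero_apply, mul_zero, mul_add, Finset.mul_sum]
  have h4 : ∑ k, 2 * (d i (ξ k) * extDer d η k j) = - 2 * ∑ k, extDer d η j k * d i (ξ k) := by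
    rw [Finset.mul_sum]
    exact Finset.sum_congr rfl fun k _ => by rw [skew k j]; ring
  -- This is d(dη) = 0 contracted with ξ.
  have h5 : ∑ k, 2 * (ξ k * d k (extDer d η i j)) =
      2 * ∑ k, ξ k * d i (extDer d η k j) + 2 * ∑ k, ξ k * d j (extDer d η i k) := by
    rw [Finset.mul_sum, Finset.mul_sum, ← Finset.sum_add_distrib]
    refine Finset.sum_congr rfl fun k _ => ?_
    linear_combination ξ k * h3 k i j - ξ k * h3 i k j - ξ k * h3 j i k
      + ξ k * h.comm k i (η j) - ξ k * h.comm k j (η i) + ξ k * h.comm i j (η k)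
  have h6 : ∑ k, ξ k * d i (extDer d η k j) = - ∑ k, ξ k * d i (extDer d η j k) := by
    rw [← Finset.sum_neg_distrib]
    exact Finset.sum_congr rfl fun k _ => by rw [skew k j]; simp
  rw [h4, h5, h6, ← Finset.mul_sum]
  linear_combination 2 * h1 - 2 * h2

/-- Product rule applied to 𝓛_ξ(GF) = 𝓛_ξ dη = 0. -/
lemma lieEnd_endo : lieEnd d ξ F = - (K * lieForm d ξ G * F) := by
  have h1 := h.lieForm_extDer
  rw [← h.contact, lieForm_mul, add_comm, ← eq_neg_iff_add_eq_zero] at h1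
  calc lieEnd d ξ F = K * (G * lieEnd d ξ F) := by
        rw [← Matrix.mul_assoc, h.inv', Matrix.one_mul]
    _ = _ := by rw [h1, Matrix.mul_neg, Matrix.mul_assoc]

/-- F² is built from ξ and η alone, and both are invariant under the flow of ξ. -/
lemma lieEnd_sq : lieEnd d ξ (F * F) = 0 := by
  rw [h.sq]
  have h1 : lieEnd d ξ (1 - vecMulVec ξ η) = lieEnd d ξ 1 - lieEnd d ξ (vecMulVec ξ η) := by
    simp only [lieEnd, Matrix.map_sub (along d ξ) (map_sub (along d ξ))]
    noncomm_ring
  have h2 : lieEnd d ξ (1 : Matrix (Fin 3) (Fin 3) R) = 0 := by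
    have h3 : (1 : Matrix (Fin 3) (Fin 3) R).map (along d ξ) = 0 := by
      ext i j; by_cases hij : i = j <;> simp [hij]
    simp [lieEnd, h3]
  rw [h1, h2, zero_sub, neg_eq_zero]
  ext i j
  have h4 := h.lie_form j
  have h5 := congrFun (along_vec (d := d) ξ) i
  have h6 : (jac d ξ * vecMulVec ξ η) i j = (jac d ξ *ᵥ ξ) i * η j := by
    rw [mul_vecMulVec]; rfl
  have h7 : (vecMulVec ξ η * jac d ξ) i j = ξ i * ((jac d ξ)ᵀ *ᵥ η) j := by
    rw [vecMulVec_mul, mulVec_transpose]; rfl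
  simp only [lieEnd, Matrix.add_apply, Matrix.sub_apply, map_apply, h6, h7, vecMulVec_apply,
    Derivation.leibniz, smul_eq_mul, Matrix.zero_apply]
  linear_combination ξ i * h4 + η j * h5

lemma shape_reeb : (K * lieForm d ξ G) *ᵥ ξ = 0 := by
  rw [← mulVec_mulVec, h.lieForm_metric_reeb, mulVec_zero]

lemma form_shape : η ᵥ* (K * lieForm d ξ G) = 0 := by
  rw [← vecMul_vecMul, ← mulVec_transpose K, h.inv_symm, h.raise, ← mulVec_transpose,
    h.lieForm_metric_symm, h.lieForm_metric_reeb]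

lemma shape_sq : K * lieForm d ξ G * (F * F) = K * lieForm d ξ G := by
  rw [h.sq, Matrix.mul_sub, mul_vecMulVec, h.shape_reeb, zero_vecMulVec, sub_zero, Matrix.mul_one]

lemma sq_shape : F * F * (K * lieForm d ξ G) = K * lieForm d ξ G := by
  rw [h.sq, Matrix.sub_mul, vecMulVec_mul, h.form_shape, vecMulVec_zero, sub_zero, Matrix.one_mul]

/-- Expand 𝓛_ξ(F²) = 0 by the product rule; F² acts as the identity next to P, so −P − FPF = 0. -/
lemma endo_shape_endo : F * (K * lieForm d ξ G) * F = - (K * lieForm d ξ G) := by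
  have h1 := h.lieEnd_sq
  rw [lieEnd_mul, h.lieEnd_endo, neg_mul, mul_neg, Matrix.mul_assoc _ F F, h.shape_sq,
    ← Matrix.mul_assoc F] at h1
  rw [eq_neg_iff_add_eq_zero, ← neg_eq_zero, ← h1]
  abel

lemma anticomm : F * (K * lieForm d ξ G) = - (K * lieForm d ξ G * F) := by
  have h1 := congrArg (· * F) h.endo_shape_endo
  simp only [Matrix.mul_assoc _ F F] at h1
  rw [Matrix.mul_assoc F, h.shape_sq, neg_mul] at h1
  exact h1

lemma trace_shape : (K * lieForm d ξ G).trace = 0 := by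
  have h1 := congrArg trace h.endo_shape_endo
  rw [Matrix.mul_assoc, trace_mul_comm, Matrix.mul_assoc, h.shape_sq, trace_neg] at h1
  exact two_cancel (by linear_combination h1)

lemma trace_endo : F.trace = 0 := by
  have hs : (extDer d η)ᵀ = - extDer d η := by
    ext i j
    simp only [extDer, of_apply, transpose_apply, Matrix.neg_apply, ← smul_neg, neg_sub]
  have h1 : F = K * extDer d η := by
    rw [← h.contact, ← Matrix.mul_assoc, h.inv', Matrix.one_mul]
  have h2 : F.trace = - F.trace := by
    conv_lhs => rw [h1, ← trace_transpose, transpose_mul, hs, h.inv_symm, neg_mul, trace_neg,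
      trace_mul_comm, ← h1]
  exact two_cancel (by linear_combination h2)

/-- After lowering an index, the symmetric part of ∇ξ is half of 𝓛_ξ g, and the skew part is −dη =
−GF by torsion-freeness. -/
lemma nab_reeb_eq :
    nab d G K ξ = algebraMap ℝ R (1 / 2) • (K * lieForm d ξ G) - F := by
  have key : G * nab d G K ξ = algebraMap ℝ R (1 / 2) • lieForm d ξ G - G * F := by
    rw [h.contact]
    ext k j
    apply two_cancel
    have e1 : (G * nab d G K ξ) k j = (G * jac d ξ) k j + ((G * gam d G K j) *ᵥ ξ) k := by
      rw [← mulVec_mulVec]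
      simp only [Matrix.mul_apply, nab, of_apply, mul_add, Finset.sum_add_distrib]
      rfl
    have e2 : 2 * ((G * gam d G K j) *ᵥ ξ) k =
        ∑ m, (d j (G m k) + d m (G j k) - d k (G j m)) * ξ m := by
      simp only [mulVec, dotProduct, Finset.mul_sum]
      exact Finset.sum_congr rfl fun m _ => by rw [← mul_assoc, mul_gam h.inv]
    have e3 : 2 * (algebraMap ℝ R (1 / 2) • lieForm d ξ G - extDer d η) k j =
        lieForm d ξ G k j - (d k (η j) - d j (η k)) := by
      rw [Matrix.sub_apply, Matrix.smul_apply, mul_sub, smul_eq_mul, ← Algebra.smul_def, two_half]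
      simp only [extDer, of_apply, two_half]
    have e4 : ∀ i j, d i (η j) = (G.map (d i) *ᵥ ξ) j + (G * jac d ξ) j i := by
      intro i j
      rw [← h.lower, MatrixCalculus.map_mulVec]; rfl
    have e5 : lieForm d ξ G k j = (∑ m, ξ m * d m (G k j)) + (G * jac d ξ) j k
        + (G * jac d ξ) k j := by
      have : ((jac d ξ)ᵀ * G) k j = (G * jac d ξ) j k := by
        conv_lhs => rw [← h.symm, ← transpose_mul]
        rfl
      simp only [lieForm, Matrix.add_apply, this, map_apply, along_apply]
    rw [e1, mul_add, e2, e3, e4, e4, e5]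
    simp only [sub_mul, add_mul, Finset.sum_sub_distrib, Finset.sum_add_distrib, mulVec,
      dotProduct, map_apply, symm_apply h.symm j k, mul_comm (ξ _)]
    have e6 : ∑ m, d j (G m k) * ξ m = ∑ m, d j (G k m) * ξ m := by
      simp only [symm_apply h.symm k]
    rw [e6]
    ring
  calc nab d G K ξ = K * (G * nab d G K ξ) := by
        rw [← Matrix.mul_assoc, h.inv', Matrix.one_mul]
    _ = _ := by
      rw [key, Matrix.mul_sub, mul_smul_comm, ← Matrix.mul_assoc, h.inv', Matrix.one_mul]

lemma nab_reeb_mulVec : nab d G K ξ *ᵥ ξ = 0 := by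
  rw [h.nab_reeb_eq, sub_mulVec, smul_mulVec, h.shape_reeb, h.reeb, smul_zero, sub_zero]

omit h in
lemma half_add : algebraMap ℝ R (1 / 2) * 2 = 1 := by
  rw [← map_ofNat (algebraMap ℝ R) 2, ← map_mul]; norm_num

/-- The Ricci curvature in the Reeb direction. -/
lemma ric_reeb : (4 : R) * (ξ ⬝ᵥ (ric d G K *ᵥ ξ)) =
    - 8 - (K * lieForm d ξ G * (K * lieForm d ξ G)).trace := by
  set P := K * lieForm d ξ G with hP
  have h1 := congrArg trace (riccati h.comm h.symm h.nab_reeb_mulVec)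
  have ht : (nab d G K ξ).trace = 0 := by
    rw [h.nab_reeb_eq, trace_sub, trace_smul, h.trace_shape, h.trace_endo]; simp
  rw [trace_jacobiOp, trace_sub, trace_neg, trace_lieEnd, ht, map_zero, h.nab_reeb_eq, ← hP] at h1
  have h2 : (F * F).trace = 2 := by
    rw [h.sq, trace_sub, trace_one, trace_vecMulVec, dotProduct_comm, h.unit]
    norm_num
  have h3 := congrArg trace h.anticomm
  rw [trace_neg, ← hP] at h3
  simp only [Matrix.sub_mul, Matrix.mul_sub, trace_sub, smul_mul_assoc, mul_smul_comm, trace_smul,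
    smul_eq_mul, h2] at h1
  have h4 := half_add (R := R)
  -- From here on `a` is an abstract ring element, known only through `a * 2 = 1`.
  set a := algebraMap ℝ R (1 / 2)
  linear_combination 4 * h1 + 4 * a * h3 - (2 * a + 1) * (P * P).trace * h4

lemma trace_shape_sq_endo :
    (K * lieForm d ξ G * (K * lieForm d ξ G) * F).trace = 0 := by
  set P := K * lieForm d ξ G with hP
  have h1 : (P * P * F).trace = - (P * P * F).trace := by
    conv_lhs => rw [Matrix.mul_assoc, trace_mul_comm, ← neg_neg (P * F), hP, ← h.anticomm, ← hP,
      neg_mul, trace_neg, Matrix.mul_assoc, trace_mul_comm]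
  exact two_cancel (by linear_combination h1)

/-- F commutes with P² while FPF = −P, so evaluating tr(P² FPF) in two ways gives tr(P³) = −tr(P³).
-/
lemma trace_shape_cube :
    (K * lieForm d ξ G * (K * lieForm d ξ G) * (K * lieForm d ξ G)).trace = 0 := by
  have h0 := h.endo_shape_endo
  have h1 := h.anticomm
  have h2 := h.sq_shape
  set P := K * lieForm d ξ G with hP
  have h3 : F * (P * P) = P * P * F := by
    rw [← Matrix.mul_assoc, h1, neg_mul, Matrix.mul_assoc, h1, mul_neg, neg_neg]
    exact (Matrix.mul_assoc P P F).symm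
  have h4 : (P * P * (F * P * F)).trace = (P * P * P).trace := by
    rw [show P * P * (F * P * F) = P * P * F * P * F by noncomm_ring, trace_mul_comm,
      show F * (P * P * F * P) = F * (P * P) * (F * P) by noncomm_ring, h3,
      show P * P * F * (F * P) = P * P * (F * F * P) by noncomm_ring, h2]
  rw [h0, mul_neg, trace_neg] at h4
  exact two_cancel (by linear_combination -h4)

/-- For a soliton the norm of the shape operator is constant, and the Riccati equation shows
that it is orthogonal to the Jacobi operator. -/
lemma trace_shape_jacobiOp (hc : along d ξ (K * lieForm d ξ G * (K * lieForm d ξ G)).trace = 0) :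
    (K * lieForm d ξ G * jacobiOp d G K ξ).trace = 0 := by
  have hF := h.lieEnd_endo
  have hPF := h.trace_shape_sq_endo
  have hPPP := h.trace_shape_cube
  have ha := h.anticomm
  have hs := h.shape_sq
  have ht := h.trace_shape
  rw [riccati h.comm h.symm h.nab_reeb_mulVec, h.nab_reeb_eq]
  set P := K * lieForm d ξ G with hP
  have h1 : along d ξ (P * P).trace = 2 * (P * lieEnd d ξ P).trace := by
    rw [← trace_lieEnd, lieEnd_mul, trace_add, trace_mul_comm _ P]; ring
  have h2 : (P * lieEnd d ξ P).trace = 0 := two_cancel (by rw [← h1, hc, mul_zero])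
  have h3 : lieEnd d ξ (algebraMap ℝ R (1 / 2) • P - F) =
      algebraMap ℝ R (1 / 2) • lieEnd d ξ P - lieEnd d ξ F := by
    have : (algebraMap ℝ R (1 / 2) • P - F).map (along d ξ) =
        algebraMap ℝ R (1 / 2) • P.map (along d ξ) - F.map (along d ξ) := by
      ext; simp
    simp only [lieEnd, this]
    simp only [Matrix.mul_sub, Matrix.sub_mul, smul_mul_assoc, mul_smul_comm, smul_sub, smul_add]
    abel
  rw [h3, hF]
  have h4 : (P * (P * F)).trace = 0 := by rw [← Matrix.mul_assoc]; exact hPF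
  have h5 : (P * (F * P)).trace = 0 := by rw [ha, mul_neg, trace_neg, h4, neg_zero]
  have h6 : (P * (P * P)).trace = 0 := by rw [← Matrix.mul_assoc]; exact hPPP
  simp only [Matrix.mul_sub, Matrix.sub_mul, smul_mul_assoc, mul_smul_comm, trace_sub, trace_smul,
    mul_neg, trace_neg, h2, h4, h5, h6, hs, ht, neg_zero, sub_zero, smul_zero]

end IsParacontact
end FormalGeometry

/-! ### A curvature contraction special to dimension three. -/

/-- Both forms live on the plane annihilated by e, whose second exterior power is a line. So their
polarised 2×2 minors form a multiple of e ⊗ e, and `hT`, which is tr(W adj(H + x ⊗ x)) = 0, says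
that the factor vanishes. -/
lemma mixed_minors_eq_zero_of_ne {e₀ e₁ e₂ x₀ x₁ x₂ h₀₀ h₀₁ h₀₂ h₁₁ h₁₂ h₂₂ w₀₀ w₀₁ w₀₂ w₁₁ w₁₂ w₂₂ : ℝ}
    (he : e₀ ≠ 0) (hu : e₀ * x₀ + e₁ * x₁ + e₂ * x₂ = 1)
    (hH₀ : h₀₀ * e₀ + h₀₁ * e₁ + h₀₂ * e₂ = 0) (hH₁ : h₀₁ * e₀ + h₁₁ * e₁ + h₁₂ * e₂ = 0)
    (hH₂ : h₀₂ * e₀ + h₁₂ * e₁ + h₂₂ * e₂ = 0)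
    (hW₀ : w₀₀ * e₀ + w₀₁ * e₁ + w₀₂ * e₂ = 0) (hW₁ : w₀₁ * e₀ + w₁₁ * e₁ + w₁₂ * e₂ = 0)
    (hW₂ : w₀₂ * e₀ + w₁₂ * e₁ + w₂₂ * e₂ = 0)
    (hT : w₀₀ * ((h₁₁ + x₁ * x₁) * (h₂₂ + x₂ * x₂) - (h₁₂ + x₁ * x₂) * (h₁₂ + x₁ * x₂))
      + w₁₁ * ((h₀₀ + x₀ * x₀) * (h₂₂ + x₂ * x₂) - (h₀₂ + x₀ * x₂) * (h₀₂ + x₀ * x₂))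
      + w₂₂ * ((h₀₀ + x₀ * x₀) * (h₁₁ + x₁ * x₁) - (h₀₁ + x₀ * x₁) * (h₀₁ + x₀ * x₁))
      + 2 * w₀₁ * ((h₀₂ + x₀ * x₂) * (h₁₂ + x₁ * x₂) - (h₀₁ + x₀ * x₁) * (h₂₂ + x₂ * x₂))
      + 2 * w₀₂ * ((h₀₁ + x₀ * x₁) * (h₁₂ + x₁ * x₂) - (h₀₂ + x₀ * x₂) * (h₁₁ + x₁ * x₁))
      + 2 * w₁₂ * ((h₀₁ + x₀ * x₁) * (h₀₂ + x₀ * x₂) - (h₀₀ + x₀ * x₀) * (h₁₂ + x₁ * x₂)) = 0) :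
    h₁₁ * w₂₂ + h₂₂ * w₁₁ - 2 * h₁₂ * w₁₂ = 0 ∧ h₀₀ * w₂₂ + h₂₂ * w₀₀ - 2 * h₀₂ * w₀₂ = 0 ∧
    h₀₀ * w₁₁ + h₁₁ * w₀₀ - 2 * h₀₁ * w₀₁ = 0 ∧
    h₀₂ * w₁₂ + h₁₂ * w₀₂ - h₀₁ * w₂₂ - h₂₂ * w₀₁ = 0 ∧
    h₀₁ * w₁₂ + h₁₂ * w₀₁ - h₀₂ * w₁₁ - h₁₁ * w₀₂ = 0 ∧
    h₀₁ * w₀₂ + h₀₂ * w₀₁ - h₀₀ * w₁₂ - h₁₂ * w₀₀ = 0 := by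
  -- As e₀ ≠ 0, the block with indices 1, 2 determines both forms.
  have a₁ : h₀₁ = -(h₁₁ * e₁ + h₁₂ * e₂) / e₀ := by field_simp; linear_combination hH₁
  have a₂ : h₀₂ = -(h₁₂ * e₁ + h₂₂ * e₂) / e₀ := by field_simp; linear_combination hH₂
  have a₀ : h₀₀ = -(h₀₁ * e₁ + h₀₂ * e₂) / e₀ := by field_simp; linear_combination hH₀
  have b₁ : w₀₁ = -(w₁₁ * e₁ + w₁₂ * e₂) / e₀ := by field_simp; linear_combination hW₁
  have b₂ : w₀₂ = -(w₁₂ * e₁ + w₂₂ * e₂) / e₀ := by field_simp; linear_combination hW₂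
  have b₀ : w₀₀ = -(w₀₁ * e₁ + w₀₂ * e₂) / e₀ := by field_simp; linear_combination hW₀
  have c : x₀ = (1 - e₁ * x₁ - e₂ * x₂) / e₀ := by field_simp; linear_combination hu
  have m : h₁₁ * w₂₂ + h₂₂ * w₁₁ - 2 * h₁₂ * w₁₂ = 0 := by
    rw [a₀, b₀, a₁, a₂, b₁, b₂, c] at hT
    field_simp at hT
    linear_combination hT
  refine ⟨m, ?_, ?_, ?_, ?_, ?_⟩
  all_goals
    rw [← mul_right_inj' (pow_ne_zero 2 he), mul_zero]
    try simp only [a₀, b₀]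
    simp only [a₁, a₂, b₁, b₂]
    field_simp
  · linear_combination e₁ ^ 2 * m
  · linear_combination e₂ ^ 2 * m
  · linear_combination e₀ * e₁ * m
  · linear_combination e₀ * e₂ * m
  · linear_combination e₁ * e₂ * m

/-- For a two-dimensional space the trace-free part of the curvature is determined by the Ricci
tensor: here `S` has the symmetries `S i j m k = - S j i m k = - S i j k m`. -/
lemma sum_skew_eq_sum_skew {G K W : Matrix (Fin 3) (Fin 3) ℝ} {ξ η : Fin 3 → ℝ}
    {S : Fin 3 → Fin 3 → Matrix (Fin 3) (Fin 3) ℝ} (hGK : G * K = 1) (hK : Kᵀ = K) (hW : Wᵀ = W)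
    (hKη : K *ᵥ η = ξ) (hWη : W *ᵥ η = 0) (hηξ : η ⬝ᵥ ξ = 1) (hWG : (W * G).trace = 0)
    (hS : ∀ i j, (S i j)ᵀ = - S i j) (hS' : ∀ i j, S j i = - S i j) :
    ∑ i, ∑ j, ∑ m, ∑ k, W i m * (ξ j * ξ k) * S i j m k =
      ∑ i, ∑ j, ∑ m, ∑ k, K i m * W j k * S i j m k := by
  have hsym : ∀ {P : Matrix (Fin 3) (Fin 3) ℝ}, Pᵀ = P → ∀ i j, P i j = P j i :=
    fun {P} h i j => by conv_lhs => rw [← h]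
                        rfl
  -- H is the inverse metric of the plane ker η.
  obtain ⟨H, hH⟩ : ∃ H : Matrix (Fin 3) (Fin 3) ℝ, H = K - vecMulVec ξ ξ := ⟨_, rfl⟩
  have hHs : Hᵀ = H := by rw [hH, transpose_sub, hK, transpose_vecMulVec]
  have hHη : H *ᵥ η = 0 := by
    rw [hH, sub_mulVec, hKη, vecMulVec_mulVec, dotProduct_comm, hηξ]; simp
  have hKH : K = of fun i j => H i j + ξ i * ξ j := by
    ext i j; simp [hH, vecMulVec_apply]
  -- Replacing G by adj K = det K · G makes the trace condition polynomial in H, W and ξ.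
  have hadj : (W * K.adjugate).trace = 0 := by
    have : K.adjugate = K.det • G := by
      calc K.adjugate = K.adjugate * (K * G) := by rw [mul_eq_one_comm.1 hGK, Matrix.mul_one]
        _ = K.det • G := by rw [← Matrix.mul_assoc, adjugate_mul, smul_mul_assoc, Matrix.one_mul]
    rw [this, mul_smul_comm, trace_smul, hWG, smul_zero]
  rw [hKH, adjugate_fin_three] at hadj
  simp only [trace, diag, Matrix.mul_apply, Fin.sum_univ_three, of_apply, cons_val', cons_val_fin_one,
    cons_val, hsym hHs 1 0, hsym hHs 2 0,
    hsym hHs 2 1, hsym hW 1 0, hsym hW 2 0, hsym hW 2 1] at hadj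
  have hH' := fun i => congrFun hHη i
  have hW' := fun i => congrFun hWη i
  simp only [mulVec, dotProduct, Fin.sum_univ_three, Pi.zero_apply] at hH' hW' hηξ
  have hM : H 1 1 * W 2 2 + H 2 2 * W 1 1 - 2 * H 1 2 * W 1 2 = 0 ∧
      H 0 0 * W 2 2 + H 2 2 * W 0 0 - 2 * H 0 2 * W 0 2 = 0 ∧
      H 0 0 * W 1 1 + H 1 1 * W 0 0 - 2 * H 0 1 * W 0 1 = 0 ∧
      H 0 2 * W 1 2 + H 1 2 * W 0 2 - H 0 1 * W 2 2 - H 2 2 * W 0 1 = 0 ∧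
      H 0 1 * W 1 2 + H 1 2 * W 0 1 - H 0 2 * W 1 1 - H 1 1 * W 0 2 = 0 ∧
      H 0 1 * W 0 2 + H 0 2 * W 0 1 - H 0 0 * W 1 2 - H 1 2 * W 0 0 = 0 := by
    have a0 := hH' 0
    have a1 := hH' 1
    have a2 := hH' 2
    have b0 := hW' 0
    have b1 := hW' 1
    have b2 := hW' 2
    simp only [hsym hHs 1 0, hsym hHs 2 0, hsym hHs 2 1, hsym hW 1 0, hsym hW 2 0,
      hsym hW 2 1] at a0 a1 a2 b0 b1 b2
    -- Some component of η is nonzero because η(ξ) = 1; the three cases differ by a transposition of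
    -- indices.
    have hne : η 0 ≠ 0 ∨ η 1 ≠ 0 ∨ η 2 ≠ 0 := by
      by_contra! hc
      simp [hc.1, hc.2.1, hc.2.2] at hηξ
    rcases hne with hne | hne | hne
    · exact mixed_minors_eq_zero_of_ne hne hηξ a0 a1 a2 b0 b1 b2 (by linear_combination hadj)
    · obtain ⟨c1, c2, c3, c4, c5, c6⟩ := mixed_minors_eq_zero_of_ne (e₀ := η 1) (e₁ := η 0)
        (e₂ := η 2) (x₀ := ξ 1) (x₁ := ξ 0) (x₂ := ξ 2) (h₀₀ := H 1 1) (h₀₁ := H 0 1)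
        (h₀₂ := H 1 2) (h₁₁ := H 0 0) (h₁₂ := H 0 2) (h₂₂ := H 2 2) (w₀₀ := W 1 1) (w₀₁ := W 0 1)
        (w₀₂ := W 1 2) (w₁₁ := W 0 0) (w₁₂ := W 0 2) (w₂₂ := W 2 2) hne
        (by linear_combination hηξ) (by linear_combination a1) (by linear_combination a0)
        (by linear_combination a2) (by linear_combination b1) (by linear_combination b0)
        (by linear_combination b2) (by linear_combination hadj)
      refine ⟨?_, ?_, ?_, ?_, ?_, ?_⟩ <;> linarith
    · obtain ⟨c1, c2, c3, c4, c5, c6⟩ := mixed_minors_eq_zero_of_ne (e₀ := η 2) (e₁ := η 1)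
        (e₂ := η 0) (x₀ := ξ 2) (x₁ := ξ 1) (x₂ := ξ 0) (h₀₀ := H 2 2) (h₀₁ := H 1 2)
        (h₀₂ := H 0 2) (h₁₁ := H 1 1) (h₁₂ := H 0 1) (h₂₂ := H 0 0) (w₀₀ := W 2 2) (w₀₁ := W 1 2)
        (w₀₂ := W 0 2) (w₁₁ := W 1 1) (w₁₂ := W 0 1) (w₂₂ := W 0 0) hne
        (by linear_combination hηξ) (by linear_combination a2) (by linear_combination a1)
        (by linear_combination a0) (by linear_combination b2) (by linear_combination b1)
        (by linear_combination b0) (by linear_combination hadj)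
      refine ⟨?_, ?_, ?_, ?_, ?_, ?_⟩ <;> linarith
  obtain ⟨m1, m2, m3, m4, m5, m6⟩ := hM
  have hd : ∀ i j m, S i j m m = 0 := fun i j m => by
    have := congrFun (congrFun (hS i j) m) m
    simp only [transpose_apply, Matrix.neg_apply] at this; linarith
  have ho : ∀ i j m k, S i j m k = - S i j k m := fun i j m k =>
    congrFun (congrFun (hS i j) k) m
  have hd' : ∀ i m k, S i i m k = 0 := fun i m k => by
    have := congrFun (congrFun (hS' i i) m) k
    simp only [Matrix.neg_apply] at this; linarith
  have ho' : ∀ i j m k, S i j m k = - S j i m k := fun i j m k =>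
    congrFun (congrFun (hS' j i) m) k
  rw [hKH]
  simp only [Fin.sum_univ_three, hd, hd', ho' 1 0, ho' 2 0, ho' 2 1, ho _ _ 1 0, ho _ _ 2 0,
    ho _ _ 2 1, hsym hHs 1 0, hsym hHs 2 0, hsym hHs 2 1, hsym hW 1 0, hsym hW 2 0, hsym hW 2 1,
    of_apply]
  -- Since S i j m k = S j i k m, the ξ ⊗ ξ part of K reproduces the left side. What remains is the
  -- contraction of S with H and W, a combination of the mixed minors.
  linear_combination (-S 0 1 0 1) * m3 - S 0 2 0 2 * m2 - S 1 2 1 2 * m1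
    + (S 0 1 0 2 + S 0 2 0 1) * m6 - (S 0 1 1 2 + S 1 2 0 1) * m5 + (S 0 2 1 2 + S 1 2 0 2) * m4

/-! ### The soliton equation forces tr(P²) = 0 and λ = −2. -/

namespace FormalGeometry
namespace IsParacontact

variable {R : Type*} [CommRing R] [Algebra ℝ R] {d : Fin 3 → Derivation ℝ R R}
variable {G K F : Matrix (Fin 3) (Fin 3) R} {ξ η : Fin 3 → R} (h : IsParacontact d G K F ξ η)
include h

omit h in
-- This and `sum_mul_ric` write the two traces as full contractions of the lowered curvature, the
-- shape needed for `sum_skew_eq_sum_skew`.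
lemma trace_mul_jacobiOp (P : Matrix (Fin 3) (Fin 3) R) :
    (P * G * jacobiOp d G K ξ).trace =
      ∑ i, ∑ j, ∑ m, ∑ k, P i m * (ξ j * ξ k) * (G * curv d G K i j) m k := by
  have h1 : ∀ i, (P * G * jacobiOp d G K ξ) i i =
      ∑ j, ξ j * ((P * (G * curv d G K i j)) *ᵥ ξ) i := by
    intro i
    simp only [← Matrix.mul_assoc, ← mulVec_mulVec (M := P * G)]
    generalize P * G = T
    simp only [Matrix.mul_apply, jacobiOp, of_apply, Finset.mul_sum]
    rw [Finset.sum_comm]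
    refine Finset.sum_congr rfl fun j _ => ?_
    rw [mulVec, dotProduct, Finset.mul_sum]
    exact Finset.sum_congr rfl fun l _ => by ring
  simp only [trace, diag, h1]
  refine Finset.sum_congr rfl fun i _ => Finset.sum_congr rfl fun j _ => ?_
  rw [← mulVec_mulVec]
  simp only [mulVec, dotProduct, Finset.mul_sum]
  exact Finset.sum_congr rfl fun m _ => Finset.sum_congr rfl fun k _ => by ring

lemma sum_mul_ric (P : Matrix (Fin 3) (Fin 3) R) :
    (P * (ric d G K)ᵀ).trace =
      ∑ i, ∑ j, ∑ m, ∑ k, K i m * P j k * (G * curv d G K i j) m k := by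
  have h1 : ∀ i j k, curv d G K i j i k = ∑ m, K i m * (G * curv d G K i j) m k := by
    intro i j k
    rw [← Matrix.mul_apply, ← Matrix.mul_assoc, h.inv', Matrix.one_mul]
  simp only [trace, diag, Matrix.mul_apply (M := P), transpose_apply, ric, of_apply]
  simp_rw [Finset.mul_sum]
  conv_lhs => enter [2, j]; rw [Finset.sum_comm]
  rw [Finset.sum_comm]
  refine Finset.sum_congr rfl fun i _ => Finset.sum_congr rfl fun j _ => ?_
  rw [Finset.sum_comm]
  refine Finset.sum_congr rfl fun k _ => ?_
  rw [h1, Finset.mul_sum]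
  exact Finset.sum_congr rfl fun m _ => by ring

variable {lam : ℝ} (hsol : lieForm d ξ G + ric d G K = lam • G)
include hsol

/-- Contract the soliton equation twice with ξ: 𝓛_ξ g drops out and ϱ(ξ, ξ) = λ. -/
lemma soliton_const :
    4 * algebraMap ℝ R lam = - 8 - (K * lieForm d ξ G * (K * lieForm d ξ G)).trace := by
  rw [← h.ric_reeb, eq_sub_of_add_eq' hsol, sub_mulVec, smul_mulVec, h.lower,
    h.lieForm_metric_reeb, sub_zero, dotProduct_smul, dotProduct_comm, h.unit, Algebra.smul_def,
    mul_one]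

/-- By `soliton_const` tr(P²) is a constant, so tr(PJ) = 0. The same contraction through ϱ equals
−tr(P²). The evaluation `ev` is there because the comparison of the two divides by a nonzero
component of η, which is possible only at a point. -/
lemma soliton_trace (ev : R →ₐ[ℝ] ℝ) :
    ev (K * lieForm d ξ G * (K * lieForm d ξ G)).trace = 0 := by
  have h1 : along d ξ (K * lieForm d ξ G * (K * lieForm d ξ G)).trace = 0 := by
    have : (K * lieForm d ξ G * (K * lieForm d ξ G)).trace =
        algebraMap ℝ R (- 8 - 4 * lam) := by
      have := h.soliton_const hsol
      simp only [map_sub, map_neg, map_mul, map_ofNat]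
      linear_combination this
    rw [this, Derivation.map_algebraMap]
  have h2 := h.trace_shape_jacobiOp h1
  have hW : (K * lieForm d ξ G * K)ᵀ = K * lieForm d ξ G * K := by
    rw [transpose_mul, transpose_mul, h.inv_symm, h.lieForm_metric_symm, Matrix.mul_assoc]
  have hWG : K * lieForm d ξ G * K * G = K * lieForm d ξ G := by
    rw [Matrix.mul_assoc, h.inv', Matrix.mul_one]
  rw [← hWG, Matrix.mul_assoc, ← Matrix.mul_assoc, trace_mul_jacobiOp] at h2
  have h3 := h.sum_mul_ric (K * lieForm d ξ G * K)
  rw [eq_sub_of_add_eq' hsol, transpose_sub, transpose_smul, h.symm, h.lieForm_metric_symm,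
    Matrix.mul_sub, mul_smul_comm, hWG, trace_sub, trace_smul, h.trace_shape, smul_zero,
    zero_sub, Matrix.mul_assoc _ K] at h3
  have e : ∀ (P Q : Matrix (Fin 3) (Fin 3) R), P.map ev * Q.map ev = (P * Q).map ev :=
    fun P Q => by ext i j; simp [Matrix.mul_apply]
  have e' : ∀ (P : Matrix (Fin 3) (Fin 3) R) (v : Fin 3 → R),
      P.map ev *ᵥ (fun i => ev (v i)) = fun i => ev ((P *ᵥ v) i) :=
    fun P v => by ext i; simp [mulVec, dotProduct]
  have key := sum_skew_eq_sum_skew (G := G.map ev) (K := K.map ev)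
    (W := (K * lieForm d ξ G * K).map ev) (ξ := fun i => ev (ξ i)) (η := fun i => ev (η i))
    (S := fun i j => (G * curv d G K i j).map ev)
    (by rw [e, h.inv]; exact Matrix.map_one ev (map_zero ev) (map_one ev))
    (by rw [← transpose_map, h.inv_symm]) (by rw [← transpose_map, hW])
    (by rw [e', h.raise])
    (by rw [e', ← mulVec_mulVec, h.raise, h.shape_reeb]; ext; simp)
    (by have := congrArg ev h.unit
        simpa [dotProduct] using this)
    (by rw [e, hWG]
        have := congrArg ev h.trace_shape
        simpa only [trace, diag, map_sum, map_zero, map_apply] using this)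
    (fun i j => by
      rw [← transpose_map, curv_skew h.comm h.symm h.inv]; ext; simp only [map_apply, Matrix.neg_apply, map_neg])
    (fun i j => by
      rw [curv_swap, mul_neg]; ext; simp only [map_apply, Matrix.neg_apply, map_neg])
  have l1 := congrArg ev h2
  have l2 := congrArg ev h3
  simp only [map_sum, map_mul, map_zero, map_neg] at l1 l2
  simp only [map_apply] at key
  rw [l1, ← l2] at key
  linarith

lemma soliton_lam (ev : R →ₐ[ℝ] ℝ) : lam = - 2 := by
  have h1 := congrArg ev (h.soliton_const hsol)
  rw [map_sub, h.soliton_trace hsol ev] at h1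
  simp only [map_mul, map_ofNat, map_neg, AlgHom.commutes, Algebra.algebraMap_self,
    RingHom.id_apply] at h1
  linarith

end IsParacontact
end FormalGeometry

/-! ### Smooth functions on an open set as a differential ring. -/

namespace Coord

lemma pd_congr {U : Set E3} (hU : IsOpen U) {f g : E3 → ℝ} (h : Set.EqOn f g U) {y : E3}
    (hy : y ∈ U) (i : Fin 3) : pd i f y = pd i g y := by
  rw [pd, pd, (h.eventuallyEq_of_mem (hU.mem_nhds hy)).fderiv_eq]

lemma contDiffOn_pd {U : Set E3} (hU : IsOpen U) {f : E3 → ℝ} (hf : ContDiffOn ℝ ∞ f U)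
    (i : Fin 3) : ContDiffOn ℝ ∞ (pd i f) U :=
  (hf.fderiv_of_isOpen hU (m := ∞) (by simp)).clm_apply contDiffOn_const

lemma pd_comm {U : Set E3} (hU : IsOpen U) {f : E3 → ℝ} (hf : ContDiffOn ℝ ∞ f U) {y : E3}
    (hy : y ∈ U) (i j : Fin 3) : pd i (pd j f) y = pd j (pd i f) y := by
  have hd : DifferentiableAt ℝ (fderiv ℝ f) y :=
    ((hf.fderiv_of_isOpen hU (m := ∞) (by simp)).contDiffAt (hU.mem_nhds hy)).differentiableAt
      (by simp)
  have hs : IsSymmSndFDerivAt ℝ f y :=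
    (hf.contDiffAt (hU.mem_nhds hy)).isSymmSndFDerivAt (by simp; exact ENat.LEInfty.out)
  have e : ∀ i j, pd i (pd j f) y =
      fderiv ℝ (fderiv ℝ f) y (EuclideanSpace.single i 1) (EuclideanSpace.single j 1) := by
    intro i j
    have : fderiv ℝ (fun z => fderiv ℝ f z (EuclideanSpace.single j 1)) y =
        (fderiv ℝ (fderiv ℝ f) y).flip (EuclideanSpace.single j 1) := by
      rw [fderiv_clm_apply hd (differentiableAt_const _)]
      simp
    exact congrFun (congrArg DFunLike.coe this) _
  rw [e, e]
  exact hs _ _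

/-- Extension of a function on `U` by zero. -/
def extendZero {U : Set E3} (f : U → ℝ) : E3 → ℝ := Function.extend Subtype.val f 0

lemma extendZero_apply {U : Set E3} (f : U → ℝ) (y : U) : extendZero f y = f y :=
  Subtype.val_injective.extend_apply f 0 y

lemma extendZero_eqOn {U : Set E3} {f : U → ℝ} {F : E3 → ℝ} (h : ∀ y : U, f y = F y) :
    Set.EqOn (extendZero f) F U := fun y hy => by
  rw [← h ⟨y, hy⟩, ← extendZero_apply f ⟨y, hy⟩]

/-- The algebra of smooth functions on `U`. -/
def smoothFun (U : Set E3) : Subalgebra ℝ (U → ℝ) where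
  carrier := {f | ContDiffOn ℝ ∞ (extendZero f) U}
  mul_mem' {f g} hf hg := (hf.mul hg).congr (extendZero_eqOn fun y => by
    simp [extendZero_apply])
  add_mem' {f g} hf hg := (hf.add hg).congr (extendZero_eqOn fun y => by
    simp [extendZero_apply])
  algebraMap_mem' r := contDiffOn_const.congr (extendZero_eqOn (F := fun _ => r) fun y => rfl)

variable {U : Set E3}

/-- Restriction of a function which is smooth on `U`. -/
def restr {F : E3 → ℝ} (hF : ContDiffOn ℝ ∞ F U) : smoothFun U :=
  ⟨fun y => F y, hF.congr (extendZero_eqOn fun _ => rfl)⟩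

/-- Evaluation of a smooth function. -/
def evalAt (y : U) : smoothFun U →ₐ[ℝ] ℝ :=
  (Pi.evalAlgHom ℝ (fun _ : U => ℝ) y).comp (smoothFun U).val

lemma evalAt_apply (y : U) (f : smoothFun U) : evalAt y f = f.1 y := rfl

lemma smoothFun_ext {f g : smoothFun U} (h : ∀ y : U, evalAt y f = evalAt y g) : f = g :=
  Subtype.ext (funext h)

lemma evalAt_restr {F : E3 → ℝ} (hF : ContDiffOn ℝ ∞ F U) (y : U) :
    evalAt y (restr hF) = F y := rfl

/-- The partial derivatives as derivations. -/
def pdDer (hU : IsOpen U) (i : Fin 3) : Derivation ℝ (smoothFun U) (smoothFun U) :=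
  Derivation.mk'
    { toFun := fun f => restr (contDiffOn_pd hU f.2 i)
      map_add' := fun f g => by
        refine smoothFun_ext fun y => ?_
        have hf := (f.2.contDiffAt (hU.mem_nhds y.2)).differentiableAt (by simp)
        have hg := (g.2.contDiffAt (hU.mem_nhds y.2)).differentiableAt (by simp)
        rw [map_add, evalAt_restr, evalAt_restr, evalAt_restr,
          pd_congr hU (g := fun z => extendZero f.1 z + extendZero g.1 z)
            (extendZero_eqOn fun z => by simp [extendZero_apply]) y.2]
        simp only [pd]
        rw [fderiv_fun_add hf hg]; rfl
      map_smul' := fun r f => by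
        refine smoothFun_ext fun y => ?_
        have hf := (f.2.contDiffAt (hU.mem_nhds y.2)).differentiableAt (by simp)
        rw [map_smul, evalAt_restr, evalAt_restr,
          pd_congr hU (g := fun z => r * extendZero f.1 z)
            (extendZero_eqOn fun z => by simp [extendZero_apply]) y.2]
        simp only [pd]
        rw [fderiv_const_mul hf]; rfl }
    fun f g => by
      refine smoothFun_ext fun y => ?_
      have hf := (f.2.contDiffAt (hU.mem_nhds y.2)).differentiableAt (by simp)
      have hg := (g.2.contDiffAt (hU.mem_nhds y.2)).differentiableAt (by simp)
      simp only [LinearMap.coe_mk, AddHom.coe_mk, map_add, smul_eq_mul, map_mul, evalAt_restr]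
      rw [pd_congr hU (g := fun z => extendZero f.1 z * extendZero g.1 z)
            (extendZero_eqOn fun z => by simp [extendZero_apply]) y.2]
      simp only [pd]
      rw [fderiv_fun_mul hf hg]
      simp [extendZero_apply, evalAt_apply]

lemma evalAt_pdDer (hU : IsOpen U) (i : Fin 3) {f : smoothFun U} {F : E3 → ℝ}
    (h : ∀ y, evalAt y f = F y) (y : U) : evalAt y (pdDer hU i f) = pd i F y :=
  pd_congr hU (extendZero_eqOn h) y.2 i

lemma pdDer_comm (hU : IsOpen U) (i j : Fin 3) (f : smoothFun U) :
    pdDer hU i (pdDer hU j f) = pdDer hU j (pdDer hU i f) := by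
  refine smoothFun_ext fun y => ?_
  have h1 : ∀ i (y : U), evalAt y (pdDer hU i f) = pd i (extendZero f.1) y := fun i y => rfl
  rw [evalAt_pdDer hU i (h1 j), evalAt_pdDer hU j (h1 i), pd_comm hU f.2 y.2]

end Coord

/-! ### From the formal identities to coordinate expressions. -/

namespace Coord

variable {U : Set E3}

lemma contDiffOn_det {P : E3 → Matrix (Fin 3) (Fin 3) ℝ}
    (hP : ∀ i j, ContDiffOn ℝ ∞ (fun y => P y i j) U) :
    ContDiffOn ℝ ∞ (fun y => (P y).det) U := by
  simp only [det_apply']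
  exact ContDiffOn.sum fun σ _ => contDiffOn_const.mul (contDiffOn_prod fun i _ => hP _ _)

lemma contDiffOn_inv {P : E3 → Matrix (Fin 3) (Fin 3) ℝ}
    (hP : ∀ i j, ContDiffOn ℝ ∞ (fun y => P y i j) U) (hdet : ∀ y ∈ U, (P y).det ≠ 0)
    (i j : Fin 3) : ContDiffOn ℝ ∞ (fun y => (P y)⁻¹ i j) U := by
  simp only [inv_def, Matrix.smul_apply, smul_eq_mul, Ring.inverse_eq_inv', adjugate_apply]
  refine ((contDiffOn_det hP).inv hdet).mul (contDiffOn_det fun a b => ?_)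
  by_cases ha : a = j
  · simp only [ha, updateRow_self]; exact contDiffOn_const
  · simp only [updateRow_ne ha]; exact hP a b

/-- The pointwise consequences of the Reeb soliton equation on a coordinate domain. -/
theorem reeb_soliton (hU : IsOpen U) {G F : E3 → Matrix (Fin 3) (Fin 3) ℝ} {ξ η : E3 → Fin 3 → ℝ}
    (hGs : ∀ i j, ContDiffOn ℝ ∞ (fun y => G y i j) U)
    (hFs : ∀ i j, ContDiffOn ℝ ∞ (fun y => F y i j) U)
    (hξs : ∀ i, ContDiffOn ℝ ∞ (fun y => ξ y i) U) (hηs : ∀ i, ContDiffOn ℝ ∞ (fun y => η y i) U)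
    (hsymm : ∀ y ∈ U, (G y)ᵀ = G y) (hdet : ∀ y ∈ U, (G y).det ≠ 0)
    (hlow : ∀ y ∈ U, G y *ᵥ ξ y = η y) (hunit : ∀ y ∈ U, η y ⬝ᵥ ξ y = 1)
    (hsq : ∀ y ∈ U, F y * F y = 1 - vecMulVec (ξ y) (η y)) (hreeb : ∀ y ∈ U, F y *ᵥ ξ y = 0)
    (hcontact : ∀ y ∈ U, G y * F y = extDeriv₁ η y) {lam : ℝ}
    (hsol : ∀ y ∈ U, lieDerivMetric ξ G y + ricci G y = lam • G y) {y : E3} (hy : y ∈ U) :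
    lam = -2 ∧ lieDerivMetric ξ G y *ᵥ ξ y = 0 ∧
      (lieDerivMetric ξ G y)ᵀ = lieDerivMetric ξ G y ∧
      ((G y)⁻¹ * lieDerivMetric ξ G y).trace = 0 ∧
      ((G y)⁻¹ * lieDerivMetric ξ G y * ((G y)⁻¹ * lieDerivMetric ξ G y)).trace = 0 := by
  have hKs := contDiffOn_inv hGs hdet
  let d := pdDer hU
  let g : Matrix (Fin 3) (Fin 3) (smoothFun U) := of fun i j => restr (hGs i j)
  let k : Matrix (Fin 3) (Fin 3) (smoothFun U) := of fun i j => restr (hKs i j)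
  let f : Matrix (Fin 3) (Fin 3) (smoothFun U) := of fun i j => restr (hFs i j)
  let x : Fin 3 → smoothFun U := fun i => restr (hξs i)
  let e : Fin 3 → smoothFun U := fun i => restr (hηs i)
  have dg : ∀ i a b y, evalAt y (d i (g a b)) = pd i (fun z => G z a b) y := fun i a b y =>
    evalAt_pdDer hU i (fun _ => rfl) y
  have dx : ∀ i a y, evalAt y (d i (x a)) = pd i (fun z => ξ z a) y := fun i a y =>
    evalAt_pdDer hU i (fun _ => rfl) y
  have de : ∀ i a y, evalAt y (d i (e a)) = pd i (fun z => η z a) y := fun i a y =>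
    evalAt_pdDer hU i (fun _ => rfl) y
  have ev : ∀ (P : Matrix (Fin 3) (Fin 3) (smoothFun U)) (Q : Matrix (Fin 3) (Fin 3) (smoothFun U))
      (y : U), (P * Q).map (evalAt y) = P.map (evalAt y) * Q.map (evalAt y) := fun P Q y => by
    ext i j; simp only [map_apply, Matrix.mul_apply, map_sum, _root_.map_mul]
  have ev' : ∀ (P : Matrix (Fin 3) (Fin 3) (smoothFun U)) (v : Fin 3 → smoothFun U) (y : U),
      (fun i => evalAt y ((P *ᵥ v) i)) = P.map (evalAt y) *ᵥ fun i => evalAt y (v i) :=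
    fun P v y => by ext i; simp only [mulVec, dotProduct, map_sum, _root_.map_mul, map_apply]
  have ext_m : ∀ {P Q : Matrix (Fin 3) (Fin 3) (smoothFun U)},
      (∀ y : U, P.map (evalAt y) = Q.map (evalAt y)) → P = Q := fun h => by
    exact Matrix.ext fun i j => smoothFun_ext fun y => congrFun (congrFun (h y) i) j
  have ext_v : ∀ {v w : Fin 3 → smoothFun U},
      (∀ y : U, (fun i => evalAt y (v i)) = fun i => evalAt y (w i)) → v = w := fun h => by
    exact funext fun i => smoothFun_ext fun y => congrFun (h y) i
  have eg : ∀ y : U, g.map (evalAt y) = G y := fun y => rfl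
  have ek : ∀ y : U, k.map (evalAt y) = (G y)⁻¹ := fun y => rfl
  have ef : ∀ y : U, f.map (evalAt y) = F y := fun y => rfl
  have ex : ∀ y : U, (fun i => evalAt y (x i)) = ξ y := fun y => rfl
  have ee : ∀ y : U, (fun i => evalAt y (e i)) = η y := fun y => rfl
  have e1 : ∀ y : U, (1 : Matrix (Fin 3) (Fin 3) (smoothFun U)).map (evalAt y) = 1 := fun y =>
    Matrix.map_one _ (map_zero _) (map_one _)
  -- Each axiom is an equation of smooth functions, hence checked by evaluation at all points of
  -- `U`.
  have hpara : FormalGeometry.IsParacontact d g k f x e :=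
    { comm := pdDer_comm hU
      symm := ext_m fun y => by rw [transpose_map, eg, hsymm y y.2]
      inv := ext_m fun y => by
        rw [ev, eg, ek, e1, mul_nonsing_inv _ (isUnit_iff_ne_zero.2 (hdet y y.2))]
      lower := ext_v fun y => by rw [ev', eg, ex, ee, hlow y y.2]
      unit := smoothFun_ext fun y => by
        rw [map_one, ← hunit y y.2]
        simp only [dotProduct, map_sum, _root_.map_mul]; rfl
      sq := ext_m fun y => by
        rw [ev, ef, hsq y y.2, Matrix.map_sub _ (map_sub _), e1]
        congr 1
      reeb := ext_v fun y => by
        rw [ev', ef, ex, hreeb y y.2]; ext; simp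
      contact := ext_m fun y => by
        rw [ev, eg, ef, hcontact y y.2]
        ext i j
        simp only [extDeriv₁, FormalGeometry.extDer, of_apply, map_apply, map_smul, map_sub, de,
          smul_eq_mul] }
  have hlie : ∀ y : U, (FormalGeometry.lieForm d x g).map (evalAt y) = lieDerivMetric ξ G y := by
    intro y
    ext i j
    simp only [FormalGeometry.lieForm, lieDerivMetric, FormalGeometry.jac, map_apply,
      Matrix.add_apply, Matrix.mul_apply, FormalGeometry.along_apply, map_add, map_sum,
      _root_.map_mul, dg, dx, transpose_apply, of_apply, Finset.sum_add_distrib]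
    congr 2
    exact Finset.sum_congr rfl fun m _ => mul_comm _ _
  have hgam : ∀ i a b (y : U), evalAt y (FormalGeometry.gam d g k i a b) = christoffel G a i b y := by
    intro i a b y
    simp only [FormalGeometry.gam, christoffel, of_apply, map_smul, map_sum, _root_.map_mul,
      map_add, map_sub, dg, smul_eq_mul]
    rfl
  have hric : ∀ y : U, (FormalGeometry.ric d g k).map (evalAt y) = ricci G y := by
    intro y
    ext a b
    simp only [FormalGeometry.ric, ricci, of_apply, map_apply, map_sum, FormalGeometry.curv,
      riemann, Matrix.add_apply, Matrix.sub_apply, Matrix.mul_apply, map_add, map_sub,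
      _root_.map_mul, hgam, Finset.sum_sub_distrib, d,
      fun j i l m => evalAt_pdDer hU j (hgam i l m)]
  have hs : FormalGeometry.lieForm d x g + FormalGeometry.ric d g k = lam • g := ext_m fun y => by
    rw [Matrix.map_add _ (map_add _), hlie, hric, hsol y y.2, ← eg]
    ext i j
    simp only [Matrix.smul_apply, map_apply, map_smul]
  have htr : ∀ P : Matrix (Fin 3) (Fin 3) (smoothFun U), ∀ y : U,
      evalAt y P.trace = (P.map (evalAt y)).trace := fun P y => by
    simp only [trace, diag, map_sum, map_apply]
  refine ⟨hpara.soliton_lam hs (evalAt ⟨y, hy⟩), ?_, ?_, ?_, ?_⟩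
  · rw [← hlie ⟨y, hy⟩, ← ex ⟨y, hy⟩, ← ev', hpara.lieForm_metric_reeb]
    ext; simp
  · rw [← hlie ⟨y, hy⟩, ← transpose_map, hpara.lieForm_metric_symm]
  · rw [← hlie ⟨y, hy⟩, ← ek ⟨y, hy⟩, ← ev, ← htr, hpara.trace_shape, map_zero]
  · rw [← hlie ⟨y, hy⟩, ← ek ⟨y, hy⟩, ← ev, ← ev, ← htr, hpara.soliton_trace hs]

end Coord

/-! ### Coordinate frames and smoothness in a chart. -/

section Charts

variable {M : Type*} [TopologicalSpace M] [ChartedSpace E3 M] [IsManifold 𝓘(ℝ, E3) ∞ M]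
  {c : OpenPartialHomeomorph M E3} (hc : c ∈ IsManifold.maximalAtlas 𝓘(ℝ, E3) ∞ M)
include hc

omit [IsManifold 𝓘(ℝ, E3) ∞ M] in
lemma mdifferentiable_of_mem_maximalAtlas : c.MDifferentiable 𝓘(ℝ, E3) 𝓘(ℝ, E3) :=
  ⟨(contMDiffOn_of_mem_maximalAtlas hc).mdifferentiableOn (by simp),
    (contMDiffOn_symm_of_mem_maximalAtlas hc).mdifferentiableOn (by simp)⟩

/-- The coordinate basis of the tangent space. -/
def coordBasis {y : E3} (hy : y ∈ c.target) :
    Module.Basis (Fin 3) ℝ (TangentSpace 𝓘(ℝ, E3) (c.symm y)) :=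
  (EuclideanSpace.basisFun (Fin 3) ℝ).toBasis.map
    (show E3 ≃ₗ[ℝ] TangentSpace 𝓘(ℝ, E3) (c.symm y) from
      ((mdifferentiable_of_mem_maximalAtlas hc).symm.mfderiv hy).toLinearEquiv)

omit [IsManifold 𝓘(ℝ, E3) ∞ M] in
lemma coordBasis_apply {y : E3} (hy : y ∈ c.target) (i : Fin 3) :
    coordBasis hc hy i = coordVec c i y := by
  rw [coordBasis, Module.Basis.map_apply, OrthonormalBasis.coe_toBasis,
    EuclideanSpace.basisFun_apply]
  rfl

omit [IsManifold 𝓘(ℝ, E3) ∞ M] in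
lemma coordBasis_repr {y : E3} (hy : y ∈ c.target) (v : TangentSpace 𝓘(ℝ, E3) (c.symm y))
    (i : Fin 3) : (coordBasis hc hy).repr v i =
      (show E3 from mfderiv 𝓘(ℝ, E3) 𝓘(ℝ, E3) c (c.symm y) v) i := rfl

lemma contMDiffOn_coordVec (i : Fin 3) :
    ContMDiffOn 𝓘(ℝ, E3) (𝓘(ℝ, E3).prod 𝓘(ℝ, E3)) ∞
      (fun y => (Bundle.TotalSpace.mk' E3 (c.symm y) (coordVec c i y) :
        TangentBundle 𝓘(ℝ, E3) M)) c.target := by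
  have h1 := (contMDiffOn_symm_of_mem_maximalAtlas hc).contMDiffOn_tangentMapWithin (m := ∞)
    (by simp) c.open_target.uniqueMDiffOn
  have h2 : ContMDiffOn 𝓘(ℝ, E3) (𝓘(ℝ, E3).prod 𝓘(ℝ, E3)) ∞
      (fun y => (⟨y, (EuclideanSpace.single i (1 : ℝ) : E3)⟩ : TangentBundle 𝓘(ℝ, E3) E3))
      c.target :=
    contMDiffOn_vectorSpace_iff_contDiffOn.2 contDiffOn_const
  refine (h1.comp h2 fun y hy => hy).congr fun y hy => ?_
  simp only [Function.comp, tangentMapWithin, mfderivWithin_of_isOpen c.open_target hy]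
  rfl

lemma contDiffOn_form {α : Π x : M, TangentSpace 𝓘(ℝ, E3) x →L[ℝ] ℝ}
    (hα : ContMDiff 𝓘(ℝ, E3) (𝓘(ℝ, E3).prod 𝓘(ℝ, E3 →L[ℝ] ℝ)) ∞
      (fun x => Bundle.TotalSpace.mk' (E3 →L[ℝ] ℝ) x (α x)))
    {v : Π y : E3, TangentSpace 𝓘(ℝ, E3) (c.symm y)}
    (hv : ContMDiffOn 𝓘(ℝ, E3) (𝓘(ℝ, E3).prod 𝓘(ℝ, E3)) ∞
      (fun y => (Bundle.TotalSpace.mk' E3 (c.symm y) (v y) : TangentBundle 𝓘(ℝ, E3) M)) c.target) :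
    ContDiffOn ℝ ∞ (fun y => α (c.symm y) (v y)) c.target := by
  intro y hy
  have hb := contMDiffOn_symm_of_mem_maximalAtlas hc y hy
  have : ContMDiffWithinAt 𝓘(ℝ, E3) (𝓘(ℝ, E3).prod 𝓘(ℝ)) ∞
      (fun m ↦ Bundle.TotalSpace.mk' ℝ (E := Bundle.Trivial M ℝ) (c.symm m)
        (α (c.symm m) (v m))) c.target y := by
    apply ContMDiffWithinAt.clm_bundle_apply (F₁ := E3)
    · exact ContMDiffAt.comp_contMDiffWithinAt y hα.contMDiffAt hb
    · exact hv y hy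
  simp only [Bundle.contMDiffWithinAt_totalSpace] at this
  exact this.2.contDiffWithinAt

lemma contDiffOn_form₂ {B : Π x : M, TangentSpace 𝓘(ℝ, E3) x →L[ℝ] TangentSpace 𝓘(ℝ, E3) x →L[ℝ] ℝ}
    (hB : ContMDiff 𝓘(ℝ, E3) (𝓘(ℝ, E3).prod 𝓘(ℝ, E3 →L[ℝ] E3 →L[ℝ] ℝ)) ∞
      (fun x => Bundle.TotalSpace.mk' (E3 →L[ℝ] E3 →L[ℝ] ℝ) x (B x)))
    {v w : Π y : E3, TangentSpace 𝓘(ℝ, E3) (c.symm y)}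
    (hv : ContMDiffOn 𝓘(ℝ, E3) (𝓘(ℝ, E3).prod 𝓘(ℝ, E3)) ∞
      (fun y => (Bundle.TotalSpace.mk' E3 (c.symm y) (v y) : TangentBundle 𝓘(ℝ, E3) M)) c.target)
    (hw : ContMDiffOn 𝓘(ℝ, E3) (𝓘(ℝ, E3).prod 𝓘(ℝ, E3)) ∞
      (fun y => (Bundle.TotalSpace.mk' E3 (c.symm y) (w y) : TangentBundle 𝓘(ℝ, E3) M)) c.target) :
    ContDiffOn ℝ ∞ (fun y => B (c.symm y) (v y) (w y)) c.target := by
  intro y hy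
  have hb := contMDiffOn_symm_of_mem_maximalAtlas hc y hy
  have : ContMDiffWithinAt 𝓘(ℝ, E3) (𝓘(ℝ, E3).prod 𝓘(ℝ)) ∞
      (fun m ↦ Bundle.TotalSpace.mk' ℝ (E := Bundle.Trivial M ℝ) (c.symm m)
        (B (c.symm m) (v m) (w m))) c.target y := by
    apply ContMDiffWithinAt.clm_bundle_apply₂ (F₁ := E3) (F₂ := E3)
    · exact ContMDiffAt.comp_contMDiffWithinAt y hB.contMDiffAt hb
    · exact hv y hy
    · exact hw y hy
  simp only [Bundle.contMDiffWithinAt_totalSpace] at this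
  exact this.2.contDiffWithinAt

lemma contMDiffOn_endo {φ : Π x : M, TangentSpace 𝓘(ℝ, E3) x →L[ℝ] TangentSpace 𝓘(ℝ, E3) x}
    (hφ : ContMDiff 𝓘(ℝ, E3) (𝓘(ℝ, E3).prod 𝓘(ℝ, E3 →L[ℝ] E3)) ∞
      (fun x => Bundle.TotalSpace.mk' (E3 →L[ℝ] E3) x (φ x)))
    {v : Π y : E3, TangentSpace 𝓘(ℝ, E3) (c.symm y)}
    (hv : ContMDiffOn 𝓘(ℝ, E3) (𝓘(ℝ, E3).prod 𝓘(ℝ, E3)) ∞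
      (fun y => (Bundle.TotalSpace.mk' E3 (c.symm y) (v y) : TangentBundle 𝓘(ℝ, E3) M)) c.target) :
    ContMDiffOn 𝓘(ℝ, E3) (𝓘(ℝ, E3).prod 𝓘(ℝ, E3)) ∞
      (fun y => (Bundle.TotalSpace.mk' E3 (c.symm y) (φ (c.symm y) (v y)) :
        TangentBundle 𝓘(ℝ, E3) M)) c.target := by
  intro y hy
  have hb := contMDiffOn_symm_of_mem_maximalAtlas hc y hy
  apply ContMDiffWithinAt.clm_bundle_apply (F₁ := E3)
  · exact ContMDiffAt.comp_contMDiffWithinAt y hφ.contMDiffAt hb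
  · exact hv y hy

end Charts

/-! ### The structure tensors in coordinates. -/

namespace AlmostParacontactMetric

variable {M : Type*} [TopologicalSpace M] [ChartedSpace E3 M] [IsManifold 𝓘(ℝ, E3) ∞ M]
  (S : AlmostParacontactMetric M) {c : OpenPartialHomeomorph M E3}
  (hc : c ∈ IsManifold.maximalAtlas 𝓘(ℝ, E3) ∞ M)

lemma g_reeb (x : M) (v : TangentSpace 𝓘(ℝ, E3) x) : S.g x v (S.ξ x) = S.η x v := by
  have h := S.g_compat x v (S.ξ x)
  rw [S.φ_ξ, map_zero, S.η_ξ] at h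
  linarith

lemma gC_symm (c : OpenPartialHomeomorph M E3) (y : E3) : (S.gC c y)ᵀ = S.gC c y := by
  ext i j; exact S.g_symm _ _ _

/-- The components of `φ` in a chart. -/
def φC (c : OpenPartialHomeomorph M E3) (y : E3) : Matrix (Fin 3) (Fin 3) ℝ :=
  of fun l i => (show E3 from mfderiv 𝓘(ℝ, E3) 𝓘(ℝ, E3) c (c.symm y)
    (S.φ (c.symm y) (coordVec c i y))) l

include hc

variable {y : E3} (hy : y ∈ c.target)
include hy

omit [IsManifold 𝓘(ℝ, E3) ∞ M] in
lemma sum_repr (v : TangentSpace 𝓘(ℝ, E3) (c.symm y)) :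
    ∑ i, (coordBasis hc hy).repr v i • coordVec c i y = v := by
  simp only [← coordBasis_apply hc hy]
  exact (coordBasis hc hy).sum_repr v

lemma φC_eq : S.φC c y =
    LinearMap.toMatrix (coordBasis hc hy) (coordBasis hc hy) (S.φ (c.symm y)).toLinearMap := by
  ext l i
  rw [LinearMap.toMatrix_apply, coordBasis_apply, coordBasis_repr]
  rfl

lemma ξC_eq : S.ξC c y = (coordBasis hc hy).repr (S.ξ (c.symm y)) := by
  ext i; rw [coordBasis_repr]; rfl

lemma gC_mulVec (v : TangentSpace 𝓘(ℝ, E3) (c.symm y)) (i : Fin 3) :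
    (S.gC c y *ᵥ ((coordBasis hc hy).repr v)) i = S.g (c.symm y) (coordVec c i y) v := by
  conv_rhs => rw [← sum_repr hc hy v, map_sum]
  simp only [mulVec, dotProduct, gC, of_apply, map_smul, smul_eq_mul, mul_comm]

lemma g_eq (v w : TangentSpace 𝓘(ℝ, E3) (c.symm y)) : S.g (c.symm y) v w =
    ((coordBasis hc hy).repr v : Fin 3 → ℝ) ⬝ᵥ (S.gC c y *ᵥ ((coordBasis hc hy).repr w)) := by
  conv_lhs => rw [← sum_repr hc hy v, map_sum]
  simp only [_root_.sum_apply, map_smul, _root_.smul_apply, dotProduct,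
    gC_mulVec, smul_eq_mul]

lemma gC_det : (S.gC c y).det ≠ 0 := by
  intro h0
  obtain ⟨v, hv, h⟩ := exists_mulVec_eq_zero_iff.2 h0
  apply hv
  let b := coordBasis hc hy
  let w := b.equivFun.symm v
  have hw : (b.repr w : Fin 3 → ℝ) = v := b.equivFun.apply_symm_apply v
  have h1 : w = 0 := S.g_nondegenerate _ _ fun u => by
    rw [S.g_symm, S.g_eq hc hy, hw, h, dotProduct_zero]
  rw [← hw, h1]; simp

lemma gC_ξC : S.gC c y *ᵥ S.ξC c y = S.ηC c y := by
  ext i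
  rw [S.ξC_eq hc hy, S.gC_mulVec hc hy, S.g_reeb]
  rfl

lemma η_eq (v : TangentSpace 𝓘(ℝ, E3) (c.symm y)) :
    S.η (c.symm y) v = S.ηC c y ⬝ᵥ ((coordBasis hc hy).repr v : Fin 3 → ℝ) := by
  conv_lhs => rw [← sum_repr hc hy v, map_sum]
  simp only [map_smul, dotProduct, ηC, smul_eq_mul, mul_comm]

lemma ηC_ξC : S.ηC c y ⬝ᵥ S.ξC c y = 1 := by
  rw [S.ξC_eq hc hy, ← S.η_eq hc hy, S.η_ξ]

lemma φC_sq : S.φC c y * S.φC c y = 1 - vecMulVec (S.ξC c y) (S.ηC c y) := by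
  rw [S.φC_eq hc hy, ← LinearMap.toMatrix_comp]
  ext l i
  rw [LinearMap.toMatrix_apply, coordBasis_apply]
  have : ((S.φ (c.symm y)).toLinearMap ∘ₗ (S.φ (c.symm y)).toLinearMap) (coordVec c i y) =
      coordVec c i y - S.ηC c y i • S.ξ (c.symm y) := S.φ_sq _ _
  rw [this, map_sub, map_smul, S.ξC_eq hc hy, ← coordBasis_apply hc hy i,
    Module.Basis.repr_self]
  simp [vecMulVec_apply, Matrix.one_apply, Finsupp.single_apply, mul_comm, eq_comm]

lemma φC_ξC : S.φC c y *ᵥ S.ξC c y = 0 := by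
  rw [S.φC_eq hc hy, S.ξC_eq hc hy, LinearMap.toMatrix_mulVec_repr]
  ext i
  have : (S.φ (c.symm y)).toLinearMap (S.ξ (c.symm y)) = 0 := S.φ_ξ _
  rw [this]; simp

lemma gC_φC : S.gC c y * S.φC c y = S.fundFormC c y := by
  ext i j
  have h := S.gC_mulVec hc hy (S.φ (c.symm y) (coordVec c j y)) i
  rw [fundFormC, of_apply, ← h]
  rfl

omit hy y

lemma contDiffOn_gC (i j : Fin 3) : ContDiffOn ℝ ∞ (fun y => S.gC c y i j) c.target :=
  contDiffOn_form₂ hc S.smooth_g (contMDiffOn_coordVec hc i) (contMDiffOn_coordVec hc j)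

lemma contDiffOn_ηC (i : Fin 3) : ContDiffOn ℝ ∞ (fun y => S.ηC c y i) c.target :=
  contDiffOn_form hc S.smooth_η (contMDiffOn_coordVec hc i)

lemma contDiffOn_fundFormC (i j : Fin 3) :
    ContDiffOn ℝ ∞ (fun y => S.fundFormC c y i j) c.target :=
  contDiffOn_form₂ hc S.smooth_g (contMDiffOn_coordVec hc i)
    (contMDiffOn_endo hc S.smooth_φ (contMDiffOn_coordVec hc j))

lemma contDiffOn_gC_inv (i j : Fin 3) : ContDiffOn ℝ ∞ (fun y => (S.gC c y)⁻¹ i j) c.target :=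
  Coord.contDiffOn_inv (S.contDiffOn_gC hc) (fun _ hy => S.gC_det hc hy) i j

/-- The components of ξ are those of η raised by the inverse metric, so their smoothness follows
from that of scalar functions already treated; likewise for φ and its fundamental form. -/
lemma contDiffOn_ξC (i : Fin 3) : ContDiffOn ℝ ∞ (fun y => S.ξC c y i) c.target := by
  have h : ContDiffOn ℝ ∞ (fun y => ∑ j, (S.gC c y)⁻¹ i j * S.ηC c y j) c.target :=
    ContDiffOn.sum fun j _ => (S.contDiffOn_gC_inv hc i j).mul (S.contDiffOn_ηC hc j)
  refine h.congr fun y hy => ?_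
  have : S.ξC c y = (S.gC c y)⁻¹ *ᵥ S.ηC c y := by
    rw [← S.gC_ξC hc hy, mulVec_mulVec, nonsing_inv_mul _ (isUnit_iff_ne_zero.2 (S.gC_det hc hy)),
      one_mulVec]
  rw [this]; rfl

lemma contDiffOn_φC (i j : Fin 3) : ContDiffOn ℝ ∞ (fun y => S.φC c y i j) c.target := by
  have h : ContDiffOn ℝ ∞ (fun y => ∑ k, (S.gC c y)⁻¹ i k * S.fundFormC c y k j) c.target :=
    ContDiffOn.sum fun k _ => (S.contDiffOn_gC_inv hc i k).mul (S.contDiffOn_fundFormC hc k j)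
  refine h.congr fun y hy => ?_
  have : S.φC c y = (S.gC c y)⁻¹ * S.fundFormC c y := by
    rw [← S.gC_φC hc hy, ← Matrix.mul_assoc,
      nonsing_inv_mul _ (isUnit_iff_ne_zero.2 (S.gC_det hc hy)), Matrix.one_mul]
  rw [this]; rfl

variable {S} in
lemma soliton_components (hS : S.IsParacontactMetric) {lam : ℝ}
    (hsol : ∀ y ∈ c.target, S.lieC c y + S.ricciC c y = lam • S.gC c y)
    {y : E3} (hy : y ∈ c.target) :
    lam = -2 ∧ S.lieC c y *ᵥ S.ξC c y = 0 ∧ (S.lieC c y)ᵀ = S.lieC c y ∧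
      ((S.gC c y)⁻¹ * S.lieC c y).trace = 0 ∧
      ((S.gC c y)⁻¹ * S.lieC c y * ((S.gC c y)⁻¹ * S.lieC c y)).trace = 0 :=
  Coord.reeb_soliton c.open_target (S.contDiffOn_gC hc) (S.contDiffOn_φC hc) (S.contDiffOn_ξC hc)
    (S.contDiffOn_ηC hc) (fun y _ => S.gC_symm c y) (fun _ hy => S.gC_det hc hy)
    (fun _ hy => S.gC_ξC hc hy) (fun _ hy => S.ηC_ξC hc hy) (fun _ hy => S.φC_sq hc hy)
    (fun _ hy => S.φC_ξC hc hy) (fun y hy => by rw [S.gC_φC hc hy, hS c hc y hy]) hsol hy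

end AlmostParacontactMetric

/-! ### Operators with square zero and their Jordan form. -/

section LinearAlgebra

lemma cayley_hamilton_three (P : Matrix (Fin 3) (Fin 3) ℝ) :
    P * P * P - P.trace • (P * P) + ((P.trace ^ 2 - (P * P).trace) / 2) • P = P.det • 1 := by
  ext i j
  fin_cases i <;> fin_cases j <;>
    simp [Matrix.mul_apply, Fin.sum_univ_three, det_fin_three, trace] <;> ring

/-- A trace-free endomorphism with trace-free square which preserves a splitting into a plane and
a line in its kernel squares to zero. -/
lemma mul_self_eq_zero_of_trace {P : Matrix (Fin 3) (Fin 3) ℝ} {ξ η : Fin 3 → ℝ}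
    (hξ : P *ᵥ ξ = 0) (hη : η ᵥ* P = 0) (hηξ : η ⬝ᵥ ξ = 1) (h1 : P.trace = 0)
    (h2 : (P * P).trace = 0) : P * P = 0 := by
  have hne : ξ ≠ 0 := by rintro rfl; simp at hηξ
  have hc := cayley_hamilton_three P
  have hx := congrArg (· *ᵥ ξ) hc
  simp only [h1, h2, zero_smul, sub_zero, ← mulVec_mulVec, hξ, mulVec_zero, smul_mulVec,
    one_mulVec, add_mulVec] at hx
  have hdet : P.det = 0 := by
    rcases smul_eq_zero.1 (by simpa using hx.symm : P.det • ξ = 0) with h | h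
    · exact h
    · exact absurd h hne
  have h3 : P * P * P = 0 := by
    rw [h1, h2, hdet] at hc; simpa using hc
  -- T is the projection onto ξ along ker η. For P + T the trace and the trace of the square are
  -- both 1, so Cayley–Hamilton reduces to −P² = det(P + T) · 1, and evaluation at ξ shows that the
  -- determinant is zero.
  set T := vecMulVec ξ η with hT
  have hPT : P * T = 0 := by rw [hT, mul_vecMulVec, hξ, zero_vecMulVec]
  have hTP : T * P = 0 := by rw [hT, vecMulVec_mul, hη, vecMulVec_zero]
  have hTT : T * T = T := by rw [hT, vecMulVec_mul_vecMulVec, hηξ]; simp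
  have htT : T.trace = 1 := by rw [hT, trace_vecMulVec, dotProduct_comm, hηξ]
  have hTξ : T *ᵥ ξ = ξ := by rw [hT, vecMulVec_mulVec, hηξ]; simp
  have hN := cayley_hamilton_three (P + T)
  have hNN : (P + T) * (P + T) = P * P + T := by
    rw [Matrix.mul_add, Matrix.add_mul, Matrix.add_mul, hPT, hTP, hTT]; abel
  have hNNN : (P * P + T) * (P + T) = T := by
    rw [Matrix.mul_add, Matrix.add_mul, Matrix.add_mul, h3, hTP, Matrix.mul_assoc, hPT, hTT]; simp
  rw [hNN, hNNN, trace_add, trace_add, h1, h2, htT] at hN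
  have hN' : - (P * P) = (P + T).det • (1 : Matrix (Fin 3) (Fin 3) ℝ) := by
    rw [← hN]; norm_num
  have hx := congrArg (· *ᵥ ξ) hN'
  simp only [neg_mulVec, ← mulVec_mulVec, hξ, mulVec_zero, smul_mulVec, one_mulVec] at hx
  have hdet : (P + T).det = 0 := by
    rcases smul_eq_zero.1 (by simpa using hx.symm : (P + T).det • ξ = 0) with h | h
    · exact h
    · exact absurd h hne
  rw [hdet, zero_smul, neg_eq_zero] at hN'
  exact hN'

lemma charpoly_of_mul_self_eq_zero {P : Matrix (Fin 3) (Fin 3) ℝ} (h : P * P = 0) :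
    ((-2 : ℝ) • 1 - P).charpoly = (Polynomial.X + Polynomial.C 2) ^ 3 := by
  have hnil : IsNilpotent P := ⟨2, by rw [pow_two, h]⟩
  have h1 := (isNilpotent_charpoly_sub_pow_of_isNilpotent hnil.neg).eq_zero
  rw [sub_eq_zero, Fintype.card_fin] at h1
  have h2 : ((-2 : ℝ) • 1 - P) = -P - scalar (Fin 3) (2 : ℝ) := by
    ext i j; simp [scalar_apply, Matrix.diagonal_apply, Matrix.one_apply]; split_ifs <;> ring
  rw [h2, charpoly_sub_scalar, h1]; simp

variable {V : Type*} [AddCommGroup V] [Module ℝ V]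

/-- The image of Q − μ is the line through `b 0`; apply rank-nullity. -/
lemma finrank_eigenspace_of_jordan {Q : V →ₗ[ℝ] V} {μ : ℝ} (b : Module.Basis (Fin 3) ℝ V)
    (h0 : Q (b 0) = μ • b 0) (h1 : Q (b 1) = μ • b 1 + b 0) (h2 : Q (b 2) = μ • b 2) :
    Module.finrank ℝ (Module.End.eigenspace Q μ) = 2 := by
  have : FiniteDimensional ℝ V := b.finiteDimensional_of_finite
  have hV : Module.finrank ℝ V = 3 := by simpa using Module.finrank_eq_card_basis b
  let T : V →ₗ[ℝ] V := Q - μ • 1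
  have hr : LinearMap.range T = Submodule.span ℝ {b 0} := by
    apply le_antisymm
    · rintro _ ⟨v, rfl⟩
      rw [← b.sum_repr v, Fin.sum_univ_three, Submodule.mem_span_singleton]
      refine ⟨b.repr v 1, ?_⟩
      simp only [T, map_add, map_smul, LinearMap.sub_apply, LinearMap.smul_apply,
        Module.End.one_apply, h0, h1, h2]
      module
    · rw [Submodule.span_singleton_le_iff_mem]
      exact ⟨b 1, by simp [T, h1]⟩
  have hk := T.finrank_range_add_finrank_ker
  rw [hr, finrank_span_singleton (b.ne_zero 0), hV] at hk
  have : Module.End.eigenspace Q μ = LinearMap.ker T := by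
    rw [Module.End.eigenspace_def]
  rw [this]; omega

variable [TopologicalSpace V]

/-- The canonical form of an operator which differs from a multiple of the identity by a nonzero
self-adjoint operator with square zero and a unit vector in its kernel. -/
lemma exists_jordan_basis (hV : Module.finrank ℝ V = 3) {B : V →L[ℝ] V →L[ℝ] ℝ}
    (hB : ∀ v w, B v w = B w v) (hnd : ∀ v, (∀ w, B v w = 0) → v = 0) {N : V →ₗ[ℝ] V}
    (hN : ∀ v w, B (N v) w = B v (N w)) (hNN : ∀ v, N (N v) = 0) (hN0 : N ≠ 0) {x : V}
    (hx : B x x = 1) (hNx : N x = 0) :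
    ∃ (ε : ℝ) (b : Module.Basis (Fin 3) ℝ V), (ε = 1 ∨ ε = -1) ∧
      N (b 0) = 0 ∧ N (b 1) = - b 0 ∧ N (b 2) = 0 ∧
      ∀ i j, B (b i) (b j) = (!![0, ε, 0; ε, 0, 0; 0, 0, 1] : Matrix (Fin 3) (Fin 3) ℝ) i j := by
  have : FiniteDimensional ℝ V := Module.finite_of_finrank_pos (by omega)
  -- B(·, N ·) is a symmetric form, nonzero because B is nondegenerate; by polarisation its
  -- quadratic form is nonzero.
  obtain ⟨v, hv⟩ : ∃ v, B v (N v) ≠ 0 := by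
    by_contra! hc
    apply hN0
    ext w
    refine hnd _ fun u => ?_
    have h1 := hc (u + w)
    simp only [map_add, _root_.add_apply, hc] at h1
    have h2 : B u (N w) = B w (N u) := by rw [← hN, hB]
    rw [hB]; linarith
  have hxN : ∀ w, B x (N w) = 0 := fun w => by rw [← hN, hNx]; simp
  obtain ⟨u, hux, hu⟩ : ∃ u, B u x = 0 ∧ B u (N u) ≠ 0 := by
    refine ⟨v - B v x • x, by simp [hx], ?_⟩
    simpa [hNx, hxN] using hv
  have hNN' : ∀ w, B (N w) (N w) = 0 := fun w => by rw [hN, hNN]; simp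
  -- N u is null, so B(u − tNu, u − tNu) = B(u, u) − 2t B(u, Nu) is linear in t; the witness uses
  -- its root.
  obtain ⟨w, hwx, hww, hw⟩ : ∃ w, B w x = 0 ∧ B w w = 0 ∧ B w (N w) ≠ 0 := by
    refine ⟨u - (B u u / (2 * B u (N u))) • N u, ?_, ?_, ?_⟩
    · simp [hux, hB (N u) x, hxN]
    · simp only [map_sub, map_smul, _root_.sub_apply, _root_.smul_apply, smul_eq_mul, hNN', hB (N u) u]
      field_simp; ring
    · simpa [hNN, hNN'] using hu
  have ha : 0 < |B w (N w)| := abs_pos.2 hw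
  obtain ⟨s, hs⟩ : ∃ s : ℝ, s ^ 2 * |B w (N w)| = 1 :=
    ⟨(√|B w (N w)|)⁻¹, by rw [inv_pow, Real.sq_sqrt ha.le, inv_mul_cancel₀ ha.ne']⟩
  obtain ⟨ε, hε, hεs⟩ : ∃ ε : ℝ, (ε = 1 ∨ ε = -1) ∧ s ^ 2 * B w (N w) = - ε := by
    rcases abs_choice (B w (N w)) with h | h <;> rw [h] at hs
    · exact ⟨-1, Or.inr rfl, by linarith⟩
    · exact ⟨1, Or.inl rfl, by linarith⟩
  -- The sign of the first vector gives N (e 1) = −e 0, so that Q = −2 − N has +e 0 in its Jordan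
  -- block.
  let e : Fin 3 → V := ![-(s • N w), s • w, x]
  have gram : ∀ i j, B (e i) (e j) =
      (!![0, ε, 0; ε, 0, 0; 0, 0, 1] : Matrix (Fin 3) (Fin 3) ℝ) i j := by
    intro i j
    fin_cases i <;> fin_cases j <;>
      simp [e, hNN', hB (N w) w, hB (N w) x, hxN, hww, hwx, hB x w, hx] <;>
      linear_combination -hεs
  have hε0 : ε ≠ 0 := by rcases hε with rfl | rfl <;> norm_num
  have hli : LinearIndependent ℝ e := by
    rw [Fintype.linearIndependent_iff]
    intro a h
    have key : ∀ j, ∑ i, a i * B (e i) (e j) = 0 := fun j => by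
      have := congrArg (fun z => B z (e j)) h
      simpa using this
    simp only [gram, Fin.sum_univ_three] at key
    have k0 := key 0
    have k1 := key 1
    have k2 := key 2
    simp [hε0] at k0 k1 k2
    intro i; fin_cases i <;> assumption
  let b := basisOfLinearIndependentOfCardEqFinrank hli (by simp [hV])
  have hb : ⇑b = e := coe_basisOfLinearIndependentOfCardEqFinrank hli _
  refine ⟨ε, b, hε, ?_, ?_, ?_, by rw [hb]; exact gram⟩
  · rw [hb]; simp [e, hNN]
  · rw [hb]; simp [e]
  · rw [hb]; simpa [e] using hNx

end LinearAlgebra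

/-! ### The Ricci operator of a soliton. -/

namespace AlmostParacontactMetric

variable {M : Type*} [TopologicalSpace M] [ChartedSpace E3 M] [IsManifold 𝓘(ℝ, E3) ∞ M]
  {S : AlmostParacontactMetric M} {c : OpenPartialHomeomorph M E3}
  (hc : c ∈ IsManifold.maximalAtlas 𝓘(ℝ, E3) ∞ M)

variable (S) in
-- At `p = c.symm y` the point `c p` equals `y` only propositionally; keeping `y` free lets `subst`
-- identify them without rewriting inside dependent types.
lemma ricciOperator_apply {p : M} {y : E3} (hp : c p = y) (v : E3) :
    (show E3 from S.ricciOperator c p v) =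
      (show E3 →L[ℝ] E3 from mfderiv 𝓘(ℝ, E3) 𝓘(ℝ, E3) c.symm y)
        (Matrix.toLpLin 2 2 ((S.gC c y)⁻¹ * S.ricciC c y)
          ((show E3 →L[ℝ] E3 from mfderiv 𝓘(ℝ, E3) 𝓘(ℝ, E3) c p) v)) := by
  subst hp; rfl

variable (S) in
include hc in
lemma ricciOperator_eq {y : E3} (hy : y ∈ c.target) :
    S.ricciOperator c (c.symm y) =
      Matrix.toLin (coordBasis hc hy) (coordBasis hc hy) ((S.gC c y)⁻¹ * S.ricciC c y) := by
  refine LinearMap.ext fun v => ?_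
  apply (coordBasis hc hy).repr.injective
  ext i
  rw [← LinearMap.toMatrix_mulVec_repr (coordBasis hc hy) (coordBasis hc hy) (Matrix.toLin _ _ _),
    LinearMap.toMatrix_toLin]
  have h := S.ricciOperator_apply (c.right_inv hy) v
  set m := (S.gC c y)⁻¹ * S.ricciC c y
  have h2 := ((mdifferentiable_of_mem_maximalAtlas hc).symm.mfderiv hy).left_inv
    (Matrix.toLpLin 2 2 m
      ((show E3 →L[ℝ] E3 from mfderiv 𝓘(ℝ, E3) 𝓘(ℝ, E3) c (c.symm y)) v))
  rw [coordBasis_repr]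
  have h3 : (show E3 from mfderiv 𝓘(ℝ, E3) 𝓘(ℝ, E3) c (c.symm y) (S.ricciOperator c (c.symm y) v)) =
      Matrix.toLpLin 2 2 m
      ((show E3 →L[ℝ] E3 from mfderiv 𝓘(ℝ, E3) 𝓘(ℝ, E3) c (c.symm y)) v) := by
    refine Eq.trans ?_ h2
    exact congrArg (show E3 →L[ℝ] E3 from mfderiv 𝓘(ℝ, E3) 𝓘(ℝ, E3) c (c.symm y)) h
  rw [h3]
  rfl

variable (hS : S.IsParacontactMetric) {lam : ℝ}
    (hsol : ∀ y ∈ c.target, S.lieC c y + S.ricciC c y = lam • S.gC c y)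
    {y : E3} (hy : y ∈ c.target)
include hc hS hsol hy

lemma ricciC_eq : S.ricciC c y = (-2 : ℝ) • S.gC c y - S.lieC c y := by
  rw [← (soliton_components hc hS hsol hy).1, ← hsol y hy, add_sub_cancel_left]

/-- If ϱ = kg at a point, then 𝓛_ξ g = (−2 − k)g there; as 𝓛_ξ g kills ξ and g(ξ, ξ) = 1, k = −2. -/
lemma ricciC_eq_of_multiple {k : ℝ} (hk : S.ricciC c y = k • S.gC c y) :
    S.ricciC c y = (-2 : ℝ) • S.gC c y := by
  have h1 := ricciC_eq hc hS hsol hy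
  obtain ⟨-, h2, -⟩ := soliton_components hc hS hsol hy
  have h3 : S.lieC c y = (-2 - k) • S.gC c y := by
    rw [hk] at h1
    rw [sub_smul, h1]; abel
  rw [h3, smul_mulVec, S.gC_ξC hc hy] at h2
  have h4 := congrArg (· ⬝ᵥ S.ξC c y) h2
  simp only [smul_dotProduct, S.ηC_ξC hc hy, zero_dotProduct, smul_eq_mul, mul_one] at h4
  rw [hk, show k = -2 by linarith]

lemma shape_sq : (S.gC c y)⁻¹ * S.lieC c y * ((S.gC c y)⁻¹ * S.lieC c y) = 0 := by
  obtain ⟨-, h1, h2, h3, h4⟩ := soliton_components hc hS hsol hy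
  refine mul_self_eq_zero_of_trace (ξ := S.ξC c y) (η := S.ηC c y) ?_ ?_ (S.ηC_ξC hc hy) h3 h4
  · rw [← mulVec_mulVec, h1, mulVec_zero]
  · have hK : (S.gC c y)⁻¹ᵀ = (S.gC c y)⁻¹ := by rw [transpose_nonsing_inv, S.gC_symm]
    rw [← vecMul_vecMul, ← mulVec_transpose (S.gC c y)⁻¹, hK, ← S.gC_ξC hc hy, mulVec_mulVec,
      nonsing_inv_mul _ (isUnit_iff_ne_zero.2 (S.gC_det hc hy)), one_mulVec, ← mulVec_transpose,
      h2, h1]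

lemma inv_mul_ricciC :
    (S.gC c y)⁻¹ * S.ricciC c y = (-2 : ℝ) • 1 - (S.gC c y)⁻¹ * S.lieC c y := by
  rw [ricciC_eq hc hS hsol hy, Matrix.mul_sub, mul_smul_comm,
    nonsing_inv_mul _ (isUnit_iff_ne_zero.2 (S.gC_det hc hy))]

lemma charpoly_ricciOperator :
    (S.ricciOperator c (c.symm y)).charpoly = (Polynomial.X + Polynomial.C 2) ^ 3 := by
  rw [S.ricciOperator_eq hc hy, Matrix.charpoly_toLin, inv_mul_ricciC hc hS hsol hy,
    charpoly_of_mul_self_eq_zero (shape_sq hc hS hsol hy)]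

lemma segre_ricciOperator (hne : S.ricciC c y ≠ (-2 : ℝ) • S.gC c y) :
    Module.finrank ℝ (Module.End.eigenspace (S.ricciOperator c (c.symm y)) (-2)) = 2 ∧
      HasDegenerateSegreType21 (fun v w => S.g (c.symm y) v w)
        (S.ricciOperator c (c.symm y)) := by
  obtain ⟨-, h1, h2, -⟩ := soliton_components hc hS hsol hy
  have hPP := shape_sq hc hS hsol hy
  have hQ := S.ricciOperator_eq hc hy
  rw [inv_mul_ricciC hc hS hsol hy] at hQ
  set b := coordBasis hc hy with hb
  set P := (S.gC c y)⁻¹ * S.lieC c y with hP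
  have hGP : S.gC c y * P = S.lieC c y := by
    rw [hP, ← Matrix.mul_assoc, mul_nonsing_inv _ (isUnit_iff_ne_zero.2 (S.gC_det hc hy)),
      Matrix.one_mul]
  set N := Matrix.toLin b b P with hN
  have hrN : ∀ v, (b.repr (N v) : Fin 3 → ℝ) = P *ᵥ b.repr v := fun v => by
    rw [← LinearMap.toMatrix_mulVec_repr b b, hN, LinearMap.toMatrix_toLin]
  have hQ' : ∀ v, S.ricciOperator c (c.symm y) v = (-2 : ℝ) • v - N v := fun v => by
    rw [hQ, map_sub, map_smul, Matrix.toLin_one]; rfl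
  have hvN : ∀ v w, S.g (c.symm y) v (N w) =
      (b.repr v : Fin 3 → ℝ) ⬝ᵥ (S.lieC c y *ᵥ b.repr w) := fun v w => by
    rw [S.g_eq hc hy, ← hb, hrN, mulVec_mulVec, hGP]
  obtain ⟨ε, e, hε, e0, e1, e2, gram⟩ := exists_jordan_basis (B := S.g (c.symm y)) (N := N)
    (x := S.ξ (c.symm y)) (by simpa using Module.finrank_eq_card_basis b) (S.g_symm _)
    (S.g_nondegenerate _)
    (fun v w => by
      rw [S.g_symm, hvN, hvN, dotProduct_mulVec, ← mulVec_transpose, h2, dotProduct_comm])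
    (fun v => by
      have : N ∘ₗ N = 0 := by rw [hN, ← Matrix.toLin_mul, hPP, map_zero]
      exact LinearMap.congr_fun this v)
    (fun h0 => hne (by
      have hP0 : P = 0 := (Matrix.toLin b b).injective (by rw [map_zero]; exact h0)
      rw [ricciC_eq hc hS hsol hy, ← hGP, hP0, Matrix.mul_zero, sub_zero]))
    (by rw [S.g_reeb, S.η_ξ])
    (by
      apply b.repr.injective
      ext i
      rw [hrN, hb, ← S.ξC_eq hc hy, hP, ← mulVec_mulVec, h1]; simp)
  have q0 : S.ricciOperator c (c.symm y) (e 0) = (-2 : ℝ) • e 0 := by rw [hQ', e0, sub_zero]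
  have q1 : S.ricciOperator c (c.symm y) (e 1) = (-2 : ℝ) • e 1 + e 0 := by
    rw [hQ', e1, sub_neg_eq_add]
  have q2 : S.ricciOperator c (c.symm y) (e 2) = (-2 : ℝ) • e 2 := by rw [hQ', e2, sub_zero]
  exact ⟨finrank_eigenspace_of_jordan e q0 q1 q2, -2, ε, e, hε, q0, q1, q2, gram⟩

end AlmostParacontactMetric

end

theorem mainTheorem9 {M : Type*} [TopologicalSpace M] [T2Space M] [SecondCountableTopology M]
    [ConnectedSpace M] [ChartedSpace E3 M] [IsManifold 𝓘(ℝ, E3) ∞ M]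
    (S : AlmostParacontactMetric M) (hS : S.IsParacontactMetric)
    (hsol : S.IsReebRicciSoliton) (hnt : ¬ S.IsEinstein) :
    (∃ c ∈ IsManifold.maximalAtlas 𝓘(ℝ, E3) ∞ M, ∃ p ∈ c.source, ¬ S.IsEinsteinAt c p) ∧
    ∀ c ∈ IsManifold.maximalAtlas 𝓘(ℝ, E3) ∞ M, ∀ p ∈ c.source,
      (S.ricciOperator c p).charpoly = (Polynomial.X + Polynomial.C 2) ^ 3 ∧
      (¬ S.IsEinsteinAt c p →
        Module.finrank ℝ (Module.End.eigenspace (S.ricciOperator c p) (-2)) = 2 ∧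
        HasDegenerateSegreType21 (fun v w => S.g p v w) (S.ricciOperator c p)) := by
  obtain ⟨lam, hsol⟩ := hsol
  refine ⟨?_, fun c hc p hp => ?_⟩
  · by_contra! h
    -- A pointwise Einstein factor can only be −2, so pointwise Einstein everywhere already gives
    -- one constant for all of M.
    refine hnt ⟨-2, fun c hc y hy => ?_⟩
    obtain ⟨k, hk⟩ := h c hc (c.symm y) (c.map_target hy)
    rw [c.right_inv hy] at hk
    exact AlmostParacontactMetric.ricciC_eq_of_multiple hc hS (hsol c hc) hy hk
  · obtain ⟨y, hy, rfl⟩ : ∃ y ∈ c.target, c.symm y = p := ⟨c p, c.map_source hp, c.left_inv hp⟩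
    refine ⟨AlmostParacontactMetric.charpoly_ricciOperator hc hS (hsol c hc) hy, fun hne => ?_⟩
    refine AlmostParacontactMetric.segre_ricciOperator hc hS (hsol c hc) hy fun h => hne ⟨-2, ?_⟩
    rw [c.right_inv hy, h]
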